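/- Let $\mathbb{k}$ be an algebraically closed field and let $R=\bigoplus_{\gamma\in\mathbb{R}_{\ge 0}}R_\gamma$ be a finitely generated $\mathbb{R}_{\ge 0}$-graded $\mathbb{k}$-algebra with $R_0=\mathbb{k}$ which is a normal (that is, integrally closed) domain of Krull dimension $n\ge 1$. For a finitely generated $\mathbb{R}$-graded $R$-module $M=\bigoplus_{\lambda\in\mathbb{R}}M_\lambda$ put $M_{\le x}=\bigoplus_{\lambda\le x}M_\lambda$, let $\operatorname{rank}(M)$ be its rank over the domain $R$, and let $a_n(M),a_{n-1}(M)\in\mathbb{R}$ be the (unique, if they exist) constants such that $\dim_{\mathbb{k}}M_{\le x}<\infty$ for all $x$, \[ \dim_{\mathbb{k}} M_{\le x}=\frac{a_n(M)}{n!}x^n+O(x^{n-1})\quad(x\to\infty), \] \[ \lim_{T\to\infty}\frac1{T^n}\int_1^T\Bigl(\dim_{\mathbb{k}} M_{\le x}-\frac{a_n(M)}{n!}x^n-\frac{a_{n-1}(M)}{(n-1)!}x^{n-1}\Bigr)dx=0 . \] The degree of $M$ is $\deg(M)=a_{n-1}(M)-\operatorname{rank}(M)\,a_{n-1}(R)$.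 The dual $M^\vee=\operatorname{Hom}_R(M,R)$ is graded by letting $(M^\vee)_\lambda$ be the set of $R$-linear maps $f:M\to R$ with $f(M_t)\subset R_{\lambda+t}$ for all $t\in\mathbb{R}$. Then for every finitely generated torsion-free $\mathbb{R}$-graded $R$-module $M$, the constants $a_n,a_{n-1}$ exist for $R$, $M$ and $M^\vee$, and \[ \deg(M^\vee)=-\deg(M). \] -/

import Mathlib

open Filter Topology Asymptotics
open scoped Nat

noncomputable section

/-- The dimension over `k` of `M_{≤ x} = ⨁_{t ≤ x} M_t`, for a family `ℳ` of homogeneous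
components `M_t`, `t : ℝ`. -/
def dimLE {k M : Type*} [Field k] [AddCommGroup M] [Module k M]
    (ℳ : ℝ → Submodule k M) (x : ℝ) : ℕ :=
  Module.finrank k (⨆ (t : ℝ) (_ : t ≤ x), ℳ t : Submodule k M)

/-- `a` and `b` are the first two coefficients `a_n(M)` and `a_{n-1}(M)` of the averaged
asymptotic Riemann-Roch expansion (to be used with `1 ≤ n`):
* every `M_{≤ x}` is finite-dimensional over `k`;
* `dim M_{≤ x} = a / n! * x ^ n + O(x ^ (n - 1))` as `x → ∞`;
* `T ^ (-n) * ∫_1^T (dim M_{≤ x} - a / n! * x ^ n - b / (n - 1)! * x ^ (n - 1)) dx → 0`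
  as `T → ∞`. -/
def IsRRCoeffs {k M : Type*} [Field k] [AddCommGroup M] [Module k M]
    (n : ℕ) (ℳ : ℝ → Submodule k M) (a b : ℝ) : Prop :=
  (∀ x : ℝ, FiniteDimensional k (⨆ (t : ℝ) (_ : t ≤ x), ℳ t : Submodule k M)) ∧
    ((fun x : ℝ => (dimLE ℳ x : ℝ) - a / (n ! : ℝ) * x ^ n) =O[atTop]
      fun x : ℝ => x ^ (n - 1)) ∧
    Tendsto
      (fun T : ℝ => 1 / T ^ n * ∫ x in (1 : ℝ)..T,
        ((dimLE ℳ x : ℝ) - a / (n ! : ℝ) * x ^ n - b / ((n - 1)! : ℝ) * x ^ (n - 1)))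
      atTop (𝓝 0)

/-- The coefficients `a_n(M)` and `a_{n-1}(M)` exist. -/
def HasRRCoeffs {k M : Type*} [Field k] [AddCommGroup M] [Module k M]
    (n : ℕ) (ℳ : ℝ → Submodule k M) : Prop :=
  ∃ a b : ℝ, IsRRCoeffs n ℳ a b

open Classical in
/-- The coefficient `a_{n-1}(M)` (and `0` if the coefficients do not exist). -/
def subCoeff {k M : Type*} [Field k] [AddCommGroup M] [Module k M]
    (n : ℕ) (ℳ : ℝ → Submodule k M) : ℝ :=
  if h : ∃ b a : ℝ, IsRRCoeffs n ℳ a b then h.choose else 0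

/-- The degree `deg M = a_{n-1}(M) - rank(M) * a_{n-1}(R)` of a graded module `M` with
components `ℳ` over a domain `R` of dimension `n` with components `𝒜`. -/
def gradedDegree {k R M : Type*} [Field k] [CommRing R] [Algebra k R]
    [AddCommGroup M] [Module k M] [Module R M]
    (n : ℕ) (𝒜 : ℝ → Submodule k R) (ℳ : ℝ → Submodule k M) : ℝ :=
  subCoeff n ℳ - (Module.finrank R M : ℝ) * subCoeff n 𝒜

/-- The grading of the dual module: the component of degree `l` consists of the `R`-linear maps
`M → R` that send `M_t` into `R_{l + t}` for every `t`, that is, of the degree-preserving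
`R`-linear maps `M(-l) → R`, where `M(-l)_t = M_{t - l}`. -/
def dualGrading {k R M : Type*} [Field k] [CommRing R] [Algebra k R]
    [AddCommGroup M] [Module k M] [Module R M]
    (𝒜 : ℝ → Submodule k R) (ℳ : ℝ → Submodule k M) (l : ℝ) :
    Submodule k (Module.Dual R M) where
  carrier := {f | ∀ t : ℝ, ∀ m ∈ ℳ t, f m ∈ 𝒜 (l + t)}
  add_mem' hf hg t m hm := by
    simpa using (𝒜 (l + t)).add_mem (hf t m hm) (hg t m hm)
  zero_mem' t m _ := by simp
  smul_mem' c f hf t m hm := by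
    simpa using (𝒜 (l + t)).smul_mem c (hf t m hm)

instance dualGrading_gradedSMul {k R M : Type*} [Field k] [CommRing R] [Algebra k R]
    [AddCommGroup M] [Module k M] [Module R M]
    (𝒜 : ℝ → Submodule k R) [GradedAlgebra 𝒜] (ℳ : ℝ → Submodule k M) :
    SetLike.GradedSMul 𝒜 (dualGrading 𝒜 ℳ) where
  smul_mem := by
    intro i j r f hr hf t m hm
    have h := SetLike.mul_mem_graded hr (hf t m hm)
    simpa [add_assoc, vadd_eq_add] using h

/-- The underlying `k`-linear map of the component of degree `l` of an `R`-linear map `f`. -/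
def dualComponentAux {k R M : Type*} [Field k] [CommRing R] [Algebra k R]
    [AddCommGroup M] [Module k M] [Module R M] [IsScalarTower k R M]
    (𝒜 : ℝ → Submodule k R) [GradedAlgebra 𝒜]
    (ℳ : ℝ → Submodule k M) [DirectSum.Decomposition ℳ]
    (l : ℝ) (f : Module.Dual R M) : M →ₗ[k] R :=
  (DirectSum.toModule k ℝ R fun t =>
      (GradedAlgebra.proj 𝒜 (l + t)) ∘ₗ (f.restrictScalars k) ∘ₗ (ℳ t).subtype) ∘ₗ
    (DirectSum.decomposeLinearEquiv ℳ).toLinearMap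

lemma dualComponentAux_of_mem {k R M : Type*} [Field k] [CommRing R] [Algebra k R]
    [AddCommGroup M] [Module k M] [Module R M] [IsScalarTower k R M]
    (𝒜 : ℝ → Submodule k R) [GradedAlgebra 𝒜]
    (ℳ : ℝ → Submodule k M) [DirectSum.Decomposition ℳ]
    (l : ℝ) (f : Module.Dual R M) {t : ℝ} {m : M} (hm : m ∈ ℳ t) :
    dualComponentAux 𝒜 ℳ l f m = (DirectSum.decompose 𝒜 (f m) (l + t) : R) := by
  simp only [dualComponentAux, LinearMap.comp_apply, LinearEquiv.coe_coe,
    DirectSum.decomposeLinearEquiv_apply, DirectSum.decompose_of_mem ℳ hm]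
  erw [DirectSum.toModule_lof]
  simp [GradedAlgebra.proj_apply]

/-- The component of degree `l` of an `R`-linear map `f : M → R`. -/
def dualComponent {k R M : Type*} [Field k] [CommRing R] [Algebra k R]
    [AddCommGroup M] [Module k M] [Module R M] [IsScalarTower k R M]
    (𝒜 : ℝ → Submodule k R) [GradedAlgebra 𝒜]
    (ℳ : ℝ → Submodule k M) [DirectSum.Decomposition ℳ] [SetLike.GradedSMul 𝒜 ℳ]
    (l : ℝ) (f : Module.Dual R M) : Module.Dual R M where
  toFun := dualComponentAux 𝒜 ℳ l f
  map_add' := map_add _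
  map_smul' r m := by
    induction r using DirectSum.Decomposition.inductionOn 𝒜 with
    | zero => simp
    | add r s hr hs => simp only [add_smul, map_add, hr, hs, RingHom.id_apply]
    | @homogeneous i r =>
      induction m using DirectSum.Decomposition.inductionOn ℳ with
      | zero => simp
      | add m m' h h' => simp only [smul_add, map_add, h, h']
      | @homogeneous t m =>
        have hm : (r : R) • (m : M) ∈ ℳ (i + t) := SetLike.GradedSMul.smul_mem r.2 m.2
        rw [dualComponentAux_of_mem 𝒜 ℳ l f hm, dualComponentAux_of_mem 𝒜 ℳ l f m.2,
          show l + (i + t) = i + (l + t) by ring, map_smul, smul_eq_mul,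
          DirectSum.coe_decompose_mul_add_of_left_mem 𝒜 r.2]
        rfl

lemma dualComponent_of_mem {k R M : Type*} [Field k] [CommRing R] [Algebra k R]
    [AddCommGroup M] [Module k M] [Module R M] [IsScalarTower k R M]
    (𝒜 : ℝ → Submodule k R) [GradedAlgebra 𝒜]
    (ℳ : ℝ → Submodule k M) [DirectSum.Decomposition ℳ] [SetLike.GradedSMul 𝒜 ℳ]
    (l : ℝ) (f : Module.Dual R M) {t : ℝ} {m : M} (hm : m ∈ ℳ t) :
    dualComponent 𝒜 ℳ l f m = (DirectSum.decompose 𝒜 (f m) (l + t) : R) :=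
  dualComponentAux_of_mem 𝒜 ℳ l f hm

/-- Over a graded ring, the dual of a finitely generated graded module is the internal direct
sum of the components `dualGrading`, so that `dualGrading` is a grading of `Module.Dual R M`. -/
theorem dualGrading_isInternal {k R M : Type*} [Field k] [CommRing R] [Algebra k R]
    [AddCommGroup M] [Module k M] [Module R M] [IsScalarTower k R M]
    (𝒜 : ℝ → Submodule k R) [GradedAlgebra 𝒜]
    (ℳ : ℝ → Submodule k M) [DirectSum.Decomposition ℳ] [SetLike.GradedSMul 𝒜 ℳ]
    [Module.Finite R M] : DirectSum.IsInternal (dualGrading 𝒜 ℳ) := by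
  classical
  have ext' : ∀ f g : Module.Dual R M, (∀ t, ∀ m ∈ ℳ t, f m = g m) → f = g := by
    intro f g h
    ext m
    induction m using DirectSum.Decomposition.inductionOn ℳ with
    | zero => simp
    | add m m' h h' => simp only [map_add, h, h']
    | homogeneous m => exact h _ _ m.2
  have hadd : ∀ l (f g : Module.Dual R M), dualComponent 𝒜 ℳ l (f + g) =
      dualComponent 𝒜 ℳ l f + dualComponent 𝒜 ℳ l g := by
    intro l f g
    refine ext' _ _ fun t m hm => ?_
    simp [dualComponent_of_mem 𝒜 ℳ l _ hm, DirectSum.decompose_add]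
  have hcoe : ∀ l (x : DirectSum ℝ fun i => dualGrading 𝒜 ℳ i),
      dualComponent 𝒜 ℳ l (DirectSum.coeAddMonoidHom (dualGrading 𝒜 ℳ) x) = x l := by
    intro l x
    induction x using DirectSum.induction_on with
    | zero =>
      refine ext' _ _ fun t m hm => ?_
      simp [dualComponent_of_mem 𝒜 ℳ l _ hm]
    | add x y hx hy => rw [map_add, hadd, hx, hy]; simp
    | of i f =>
      refine ext' _ _ fun t m hm => ?_
      rw [dualComponent_of_mem 𝒜 ℳ l _ hm, DirectSum.coeAddMonoidHom_of]
      have hf := f.2 t m hm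
      by_cases hil : i = l
      · subst hil
        rw [DirectSum.decompose_of_mem_same 𝒜 hf]
        simp
      · rw [DirectSum.decompose_of_mem_ne 𝒜 hf (by simpa using hil),
          DirectSum.of_eq_of_ne _ _ _ (Ne.symm hil)]
        simp
  refine ⟨fun x y hxy => ?_, fun f => ?_⟩
  · ext1 l
    exact Subtype.ext (by rw [← hcoe l x, ← hcoe l y, hxy])
  · have hmem : ∀ l, dualComponent 𝒜 ℳ l f ∈ dualGrading 𝒜 ℳ l := by
      intro l t m hm
      rw [dualComponent_of_mem 𝒜 ℳ l f hm]
      exact SetLike.coe_mem _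
    have hfin : ∀ m : M, ∃ S : Finset ℝ, ∀ S' : Finset ℝ, S ⊆ S' →
        ∑ l ∈ S', dualComponent 𝒜 ℳ l f m = f m := by
      intro m
      induction m using DirectSum.Decomposition.inductionOn ℳ with
      | zero => exact ⟨∅, by simp⟩
      | add m m' h h' =>
        obtain ⟨S, hS⟩ := h
        obtain ⟨T, hT⟩ := h'
        refine ⟨S ∪ T, fun S' hS' => ?_⟩
        simp only [map_add, Finset.sum_add_distrib]
        rw [hS S' (Finset.union_subset_left hS'), hT S' (Finset.union_subset_right hS')]
      | @homogeneous t m =>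
        refine ⟨(DirectSum.decompose 𝒜 (f m)).support.image (fun s => s - t),
          fun S' hS' => ?_⟩
        conv_rhs => rw [← DirectSum.sum_support_decompose 𝒜 (f (m : M))]
        rw [← Finset.sum_subset hS', Finset.sum_image (by intro a _ b _ h; simpa using h)]
        · refine Finset.sum_congr rfl fun s _ => ?_
          rw [dualComponent_of_mem 𝒜 ℳ _ f m.2, sub_add_cancel]
        · intro l _ hl
          rw [dualComponent_of_mem 𝒜 ℳ _ f m.2]
          by_contra hne
          refine hl (Finset.mem_image.2 ⟨l + t, ?_, by ring⟩)
          rw [DFinsupp.mem_support_iff]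
          exact fun h0 => hne (by rw [h0]; rfl)
    choose S hS using hfin
    obtain ⟨G, hG⟩ := (Module.finite_def.1 ‹Module.Finite R M› : (⊤ : Submodule R M).FG)
    refine ⟨∑ l ∈ G.biUnion S, DirectSum.of (fun i => dualGrading 𝒜 ℳ i) l ⟨_, hmem l⟩, ?_⟩
    rw [map_sum]
    simp only [DirectSum.coeAddMonoidHom_of]
    refine LinearMap.ext_on hG fun g hg => ?_
    rw [LinearMap.sum_apply]
    exact hS g _ (Finset.subset_biUnion_of_mem S hg)

/-- The coefficients `a_n(M)` and `a_{n-1}(M)` are unique. -/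
theorem IsRRCoeffs.unique {k M : Type*} [Field k] [AddCommGroup M] [Module k M]
    {n : ℕ} (hn : 1 ≤ n) {ℳ : ℝ → Submodule k M} {a b a' b' : ℝ}
    (h : IsRRCoeffs n ℳ a b) (h' : IsRRCoeffs n ℳ a' b') : a = a' ∧ b = b' := by
  obtain ⟨hfin, hO, hT⟩ := h
  obtain ⟨-, hO', hT'⟩ := h'
  have hn0 : (n ! : ℝ) ≠ 0 := by positivity
  have hm0 : ((n - 1)! : ℝ) ≠ 0 := by positivity
  have key : ∀ c : ℝ, ((fun x : ℝ => c * x ^ n) =O[atTop] fun x : ℝ => x ^ (n - 1)) →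
      c = 0 := by
    intro c hc
    by_contra hne
    have h1 : (fun x : ℝ => x ^ n) =O[atTop] fun x : ℝ => x ^ (n - 1) :=
      (isBigO_const_mul_left_iff hne).1 hc
    have h2 : (fun x : ℝ => x ^ (n - 1)) =o[atTop] fun x : ℝ => x ^ n :=
      isLittleO_pow_pow_atTop_of_lt (by omega)
    have h3 := (h1.trans_isLittleO h2)
    have h4 := isLittleO_irrefl (f'' := fun x : ℝ => x ^ n) (l := atTop)
      (Eventually.frequently ((eventually_gt_atTop 0).mono fun x hx => (pow_pos hx n).ne'))
    exact h4 h3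
  have ha : a = a' := by
    have := key (a' / (n ! : ℝ) - a / (n ! : ℝ)) ((hO.sub hO').congr_left fun x => by ring)
    field_simp at this
    linarith
  subst ha
  refine ⟨rfl, ?_⟩
  have hmono : Monotone fun x : ℝ => (dimLE ℳ x : ℝ) := by
    intro x y hxy
    have := hfin y
    have hle : (⨆ (t : ℝ) (_ : t ≤ x), ℳ t : Submodule k M) ≤
        (⨆ (t : ℝ) (_ : t ≤ y), ℳ t : Submodule k M) :=
      iSup_mono fun t => iSup_mono' fun h => ⟨h.trans hxy, le_rfl⟩
    exact Nat.cast_le.2 (Submodule.finrank_mono hle)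
  have hint : ∀ (c : ℝ) (T : ℝ), IntervalIntegrable (fun x : ℝ => (dimLE ℳ x : ℝ) -
      a / (n ! : ℝ) * x ^ n - c / ((n - 1)! : ℝ) * x ^ (n - 1)) MeasureTheory.volume 1 T := by
    intro c T
    exact (hmono.intervalIntegrable.sub (Continuous.intervalIntegrable (by fun_prop) _ _)).sub
      (Continuous.intervalIntegrable (by fun_prop) _ _)
  have hd := hT.sub hT'
  have heq : ∀ T : ℝ, 0 < T →
      1 / T ^ n * (∫ x in (1 : ℝ)..T, ((dimLE ℳ x : ℝ) - a / (n ! : ℝ) * x ^ n -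
          b / ((n - 1)! : ℝ) * x ^ (n - 1))) -
        1 / T ^ n * (∫ x in (1 : ℝ)..T, ((dimLE ℳ x : ℝ) - a / (n ! : ℝ) * x ^ n -
          b' / ((n - 1)! : ℝ) * x ^ (n - 1))) =
      (b' - b) / ((n - 1)! : ℝ) / n * (1 - (T ^ n)⁻¹) := by
    intro T hTpos
    rw [← mul_sub, ← intervalIntegral.integral_sub (hint b T) (hint b' T)]
    have : ∀ x : ℝ, ((dimLE ℳ x : ℝ) - a / (n ! : ℝ) * x ^ n -
          b / ((n - 1)! : ℝ) * x ^ (n - 1)) - ((dimLE ℳ x : ℝ) - a / (n ! : ℝ) * x ^ n -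
          b' / ((n - 1)! : ℝ) * x ^ (n - 1)) =
        (b' - b) / ((n - 1)! : ℝ) * x ^ (n - 1) := fun x => by ring
    simp only [this]
    rw [intervalIntegral.integral_const_mul, integral_pow, Nat.sub_add_cancel hn]
    have hnR : (n : ℝ) ≠ 0 := by exact_mod_cast (by omega : n ≠ 0)
    rw [Nat.cast_sub hn]
    simp only [one_pow, Nat.cast_one, sub_add_cancel]
    field_simp
  have hlim : Tendsto (fun T : ℝ => (b' - b) / ((n - 1)! : ℝ) / n * (1 - (T ^ n)⁻¹)) atTop
      (𝓝 ((b' - b) / ((n - 1)! : ℝ) / n * (1 - 0))) :=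
    ((tendsto_const_nhds.sub
      (tendsto_inv_atTop_zero.comp (tendsto_pow_atTop (by omega)))).const_mul _)
  have hd' := hd.congr' ((eventually_gt_atTop 0).mono heq)
  have := tendsto_nhds_unique hlim hd'
  have hnR : (n : ℝ) ≠ 0 := by exact_mod_cast (by omega : n ≠ 0)
  field_simp at this
  linarith

end

/-!
Let `h_N x = dim_k (N ∩ M_{≤ x})` be the Hilbert function of a homogeneous submodule `N` of `M`.

If `f x - f (x - t)`, `t > 0`, has an averaged expansion of order `s`, then `f` has one of order
`s + 1`. For homogeneous `N < N'` there is a homogeneous `m ∈ N'`, of degree `e` say, whose colon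
ideal `P = (N : m)` is prime, and `h_{N + Rm} - h_N` is the Hilbert function of `R / P` translated
by `e`. Induction on the coheight of primes therefore gives expansions of all Hilbert functions, and
if `dim R = d + 1`, then a quotient killed by some `s ≠ 0` has an expansion of order `d`. Write
`lead` for its leading coefficient.

Normality enters through functionals with values in a principal ideal `qR`: for a homogeneous prime
`P ≠ 0` one has `lead ((qR : P) / qR) ≤ lead (R / P)`. Indeed, let `a ∈ (qR : P)` be homogeneous and
not in `qR`. Then `aP` is not contained in `qP`, as otherwise `a / q` would be integral over `R`, so
`a p = q c` with `p ∈ P` and `c ∉ P`. Hence `c (qR : P) ⊆ aR`, so `(qR : P) / (q, a)` is killed by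
an ideal strictly larger than `P` and has `lead` zero, while `(q, a) / qR` is a translate of a
quotient of `R / P`. By dévissage, `lead (N^♯ / N'^♯) ≤ lead (N' / N)` when `N' / N` is torsion,
where `N^♯` consists of the functionals sending `N` into `qR`.

Now let `F ≤ M` be free on homogeneous elements `m_1, …, m_r` of degrees `e_i`, with `s M ≤ F` for a
homogeneous `s ≠ 0`, and let `G ≤ M^∨` be the span of the functionals `s m_i^*`. The inequality for
`F ≤ M` and `q = s` reads `lead (G / s M^∨) ≤ lead (M / F)`, and for `s M ≤ F` and `q = s ^ 2` it
reads `lead (M^∨ / G) ≤ lead (F / s M)`. The two left sides and the two right sides have the same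
sum `r lead (R / sR)`, so both inequalities are equalities. If
`h_R x = A x ^ (d + 1) + (d + 1) B x ^ d + o(x ^ d)` on average and `c = lead (M / F)`, then `h_M`
and `h_{M^∨}` have the coefficients `r B - A ∑ e_i + c / (d + 1)` and `r B + A ∑ e_i - c / (d + 1)`
in place of `B`, with sum `2 r B`.
-/

noncomputable section

section Asymptotics

open MeasureTheory Set

/-- The derivative of `x ^ s`, used as an error term. It vanishes identically for `s = 0`, so that
`f =O[atTop] powDeriv 0` means that `f` is eventually zero. -/
def powDeriv (s : ℕ) (x : ℝ) : ℝ := s * x ^ (s - 1)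

@[simp]
lemma powDeriv_zero : powDeriv 0 = 0 := by
  ext x
  simp [powDeriv]

lemma powDeriv_succ (s : ℕ) (x : ℝ) : powDeriv (s + 1) x = (s + 1) * x ^ s := by
  simp [powDeriv]

lemma powDeriv_nonneg {x : ℝ} (hx : 0 ≤ x) (s : ℕ) : 0 ≤ powDeriv s x := by
  unfold powDeriv
  positivity

lemma powDeriv_mul_self (s : ℕ) (x : ℝ) : powDeriv s x * x = s * x ^ s := by
  cases s with
  | zero => simp
  | succ s => simp only [powDeriv_succ]; push_cast; ring

lemma powDeriv_isLittleO_pow (s : ℕ) : powDeriv s =o[atTop] fun x : ℝ => x ^ s := by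
  cases s with
  | zero => exact powDeriv_zero ▸ isLittleO_zero (fun x : ℝ => x ^ 0) _
  | succ s =>
    simp only [funext (powDeriv_succ s)]
    exact (isLittleO_pow_pow_atTop_of_lt s.lt_succ_self).const_mul_left _

lemma pow_isBigO_powDeriv_succ (s : ℕ) :
    (fun x : ℝ => x ^ s) =O[atTop] powDeriv (s + 1) := by
  have hs : (s : ℝ) + 1 ≠ 0 := by positivity
  refine (isBigO_const_mul_self ((s : ℝ) + 1)⁻¹ (powDeriv (s + 1)) atTop).congr_left fun x => ?_
  rw [powDeriv_succ]
  field_simp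

lemma powDeriv_succ_isBigO_pow (s : ℕ) :
    powDeriv (s + 1) =O[atTop] fun x : ℝ => x ^ s := by
  simp only [funext (powDeriv_succ s)]
  exact isBigO_const_mul_self _ _ _

lemma mul_powDeriv_isBigO_powDeriv_succ (s : ℕ) :
    (fun x : ℝ => x * powDeriv s x) =O[atTop] powDeriv (s + 1) := by
  simp only [mul_comm _ (powDeriv s _), powDeriv_mul_self]
  exact (pow_isBigO_powDeriv_succ s).const_mul_left _

lemma sub_const_pow_isBigO_pow (c : ℝ) (s : ℕ) :
    (fun x : ℝ => (x - c) ^ s) =O[atTop] fun x : ℝ => x ^ s :=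
  ((isBigO_refl _ _).sub (isLittleO_const_id_atTop c).isBigO).pow s

lemma powDeriv_sub_const_isBigO (c : ℝ) (s : ℕ) :
    (fun x : ℝ => powDeriv s (x - c)) =O[atTop] powDeriv s :=
  (isBigO_refl _ _).mul (sub_const_pow_isBigO_pow c (s - 1))

lemma const_mul_pow_isBigO_powDeriv_succ (a : ℝ) (s : ℕ) :
    (fun x : ℝ => a * x ^ s) =O[atTop] powDeriv (s + 1) :=
  (pow_isBigO_powDeriv_succ s).const_mul_left a

lemma const_isBigO_pow (K : ℝ) (s : ℕ) :
    (fun _ : ℝ => K) =O[atTop] fun x : ℝ => x ^ s := by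
  have h : (fun _ : ℝ => K) =O[atTop] fun _ : ℝ => (1 : ℝ) := isBigO_const_const _ one_ne_zero _
  refine h.trans (IsBigO.of_bound 1 ?_)
  filter_upwards [eventually_ge_atTop 1] with x hx
  rw [one_mul, norm_one]
  exact (one_le_pow₀ hx).trans (le_abs_self _)

lemma pow_succ_sub_shift_isBigO_powDeriv (c : ℝ) (s : ℕ) :
    (fun x : ℝ => x ^ (s + 1) - (x - c) ^ (s + 1) - (s + 1) * c * x ^ s) =O[atTop]
      powDeriv s := by
  induction s with
  | zero => exact (isBigO_zero _ _).congr_left fun x => by simp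
  | succ s ih =>
    have hmul := ((isBigO_refl (fun x : ℝ => x) atTop).mul ih).trans
      (mul_powDeriv_isBigO_powDeriv_succ s)
    have hdiff : (fun x : ℝ => (x - c) ^ (s + 1) - x ^ (s + 1)) =O[atTop] powDeriv (s + 1) := by
      have hlead := const_mul_pow_isBigO_powDeriv_succ ((s + 1) * c) s
      have herr := ih.trans ((powDeriv_isLittleO_pow s).isBigO.trans (pow_isBigO_powDeriv_succ s))
      exact (herr.add hlead).neg_left.congr_left fun x => by ring
    refine (hmul.add (hdiff.const_mul_left c)).congr_left fun x => ?_
    push_cast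
    ring

lemma pow_sub_shift_isBigO_powDeriv (c : ℝ) (s : ℕ) :
    (fun x : ℝ => x ^ s - (x - c) ^ s) =O[atTop] powDeriv s := by
  cases s with
  | zero => exact (isBigO_zero _ _).congr_left fun x => by simp
  | succ s =>
    have herr := (pow_succ_sub_shift_isBigO_powDeriv c s).trans
      ((powDeriv_isLittleO_pow s).isBigO.trans (pow_isBigO_powDeriv_succ s))
    exact (herr.add (const_mul_pow_isBigO_powDeriv_succ ((s + 1) * c) s)).congr_left
      fun x => by ring

lemma pow_add_two_sub_shift_isLittleO_pow (c : ℝ) (s : ℕ) :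
    (fun x : ℝ => x ^ (s + 2) - (x - c) ^ (s + 2) - (s + 2) * c * x ^ (s + 1) +
      (s + 2) * (s + 1) / 2 * c ^ 2 * x ^ s) =o[atTop] fun x : ℝ => x ^ s := by
  induction s with
  | zero =>
    refine (isLittleO_zero _ _).congr_left fun x => ?_
    simp
    ring
  | succ s ih =>
    have hmul := ((isBigO_refl (fun x : ℝ => x) atTop).mul_isLittleO ih).congr_right
      fun x => (pow_succ' x s).symm
    have hfirst := (pow_succ_sub_shift_isBigO_powDeriv c (s + 1)).trans_isLittleO
      (powDeriv_isLittleO_pow (s + 1))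
    refine (hmul.sub (hfirst.const_mul_left c)).congr_left fun x => ?_
    push_cast
    ring

lemma pow_add_mul_powDeriv_le {x d : ℝ} (hx : 0 ≤ x) (hd : 0 ≤ d) (s : ℕ) :
    x ^ s + d * powDeriv s x ≤ (x + d) ^ s := by
  induction s with
  | zero => simp
  | succ s ih =>
    have herr : 0 ≤ d ^ 2 * powDeriv s x := mul_nonneg (sq_nonneg d) (powDeriv_nonneg hx s)
    calc x ^ (s + 1) + d * powDeriv (s + 1) x
        ≤ x ^ (s + 1) + d * powDeriv (s + 1) x + d ^ 2 * powDeriv s x := by linarith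
      _ = (x ^ s + d * powDeriv s x) * (x + d) := by
        rw [powDeriv_succ]
        linear_combination -d * powDeriv_mul_self s x
      _ ≤ (x + d) ^ s * (x + d) := by gcongr
      _ = (x + d) ^ (s + 1) := (pow_succ _ _).symm

lemma abs_le_of_abs_sub_shift_le {D : ℝ → ℝ} {d C x₀ K : ℝ} {s : ℕ} (hd : 0 < d) (hC : 0 ≤ C)
    (hx₀ : 0 ≤ x₀) (hdiff : ∀ x, x₀ ≤ x → |D x - D (x - d)| ≤ C * powDeriv s x)
    (hK : ∀ x ∈ Icc (x₀ - d) x₀, |D x| ≤ K) {x : ℝ} (hx : x₀ ≤ x) :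
    |D x| ≤ C / d * (x + d) ^ s + K := by
  have key (j : ℕ) : ∀ x, x₀ - d ≤ x → x ≤ x₀ + j * d → |D x| ≤ C / d * (x + d) ^ s + K := by
    induction j with
    | zero =>
      intro x hx hx'
      have hxd : 0 ≤ x + d := by linarith
      have hpos : 0 ≤ C / d * (x + d) ^ s := by positivity
      linarith [hK x ⟨hx, by simpa using hx'⟩]
    | succ j ih =>
      intro x hx hx'
      by_cases hxj : x ≤ x₀ + j * d
      · exact ih x hx hxj
      have hj : 0 ≤ (j : ℝ) * d := by positivity
      have hx0 : x₀ ≤ x := by linarith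
      have hprev : |D (x - d)| ≤ C / d * x ^ s + K := by
        simpa using ih (x - d) (by linarith) (by push_cast at hx'; linarith)
      calc |D x| ≤ |D x - D (x - d)| + |D (x - d)| := by
            simpa using abs_add_le (D x - D (x - d)) (D (x - d))
        _ ≤ C * powDeriv s x + (C / d * x ^ s + K) := add_le_add (hdiff x hx0) hprev
        _ = C / d * (x ^ s + d * powDeriv s x) + K := by field_simp; ring
        _ ≤ C / d * (x + d) ^ s + K := by
          gcongr
          exact pow_add_mul_powDeriv_le (hx₀.trans hx0) hd.le s
  obtain ⟨j, hj⟩ := exists_nat_ge ((x - x₀) / d)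
  rw [div_le_iff₀ hd] at hj
  exact key j x (by linarith) (by linarith)

lemma exists_abs_le_of_isBigOWith_sub_shift {D : ℝ → ℝ} {d C : ℝ} {s : ℕ} (hd : 0 < d)
    (hC : 0 ≤ C) (hb : ∀ y, ∃ K, ∀ x ∈ Icc (y - d) y, |D x| ≤ K)
    (h : IsBigOWith C atTop (fun x => D x - D (x - d)) (powDeriv s)) :
    ∃ K, ∀ᶠ x in atTop, |D x| ≤ C / d * (x + d) ^ s + K := by
  obtain ⟨x₀, hx₀⟩ := eventually_atTop.1 h.bound
  obtain ⟨K, hK⟩ := hb (max x₀ 0)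
  refine ⟨K, (eventually_ge_atTop (max x₀ 0)).mono fun x hx => ?_⟩
  refine abs_le_of_abs_sub_shift_le hd hC (le_max_right x₀ 0) (fun y hy => ?_) hK hx
  have hbound := hx₀ y ((le_max_left _ _).trans hy)
  rwa [Real.norm_eq_abs, Real.norm_eq_abs,
    abs_of_nonneg (powDeriv_nonneg ((le_max_right x₀ 0).trans hy) s)] at hbound

lemma isBigO_pow_of_sub_shift {D : ℝ → ℝ} {d : ℝ} {s : ℕ} (hd : 0 < d)
    (hb : ∀ y, ∃ K, ∀ x ∈ Icc (y - d) y, |D x| ≤ K)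
    (h : (fun x => D x - D (x - d)) =O[atTop] powDeriv s) : D =O[atTop] fun x : ℝ => x ^ s := by
  obtain ⟨C, hC, hCD⟩ := h.exists_nonneg
  obtain ⟨K, hK⟩ := exists_abs_le_of_isBigOWith_sub_shift hd hC hb hCD
  have hpow : (fun x : ℝ => C / d * (x + d) ^ s) =O[atTop] fun x : ℝ => x ^ s := by
    simpa using (sub_const_pow_isBigO_pow (-d) s).const_mul_left (C / d)
  refine IsBigO.trans (IsBigO.of_bound 1 ?_) (hpow.add (const_isBigO_pow K s))
  filter_upwards [hK] with x hx
  rw [one_mul]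
  exact hx.trans (le_abs_self _)

lemma isLittleO_pow_of_sub_shift {D : ℝ → ℝ} {d : ℝ} {s : ℕ} (hd : 0 < d)
    (hb : ∀ y, ∃ K, ∀ x ∈ Icc (y - d) y, |D x| ≤ K)
    (h : (fun x => D x - D (x - d)) =o[atTop] fun x : ℝ => x ^ s) :
    D =o[atTop] fun x : ℝ => x ^ (s + 1) := by
  rw [isLittleO_iff]
  intro ε hε
  set C : ℝ := ε * d / 2 ^ (s + 2) with hC
  have hC0 : 0 < C := by positivity
  obtain ⟨K, hK⟩ := exists_abs_le_of_isBigOWith_sub_shift hd hC0.le hb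
    ((h.trans_isBigO (pow_isBigO_powDeriv_succ s)).forall_isBigOWith hC0)
  have hlarge : ∀ᶠ x : ℝ in atTop, 2 * K / ε ≤ x ^ (s + 1) :=
    (tendsto_pow_atTop s.succ_ne_zero).eventually_ge_atTop _
  filter_upwards [hK, hlarge, eventually_ge_atTop d] with x hDx hKx hdx
  have hx : 0 ≤ x := hd.le.trans hdx
  rw [div_le_iff₀ hε] at hKx
  rw [Real.norm_eq_abs, Real.norm_eq_abs, abs_of_nonneg (pow_nonneg hx _)]
  calc |D x| ≤ C / d * (x + d) ^ (s + 1) + K := hDx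
    _ ≤ C / d * (2 * x) ^ (s + 1) + K := by gcongr; linarith
    _ = ε / 2 * x ^ (s + 1) + K := by
      rw [hC, mul_pow, pow_succ 2 (s + 1)]
      field_simp
    _ ≤ ε * x ^ (s + 1) := by linarith

lemma setIntegral_Iic_comp_sub_right (f : ℝ → ℝ) (c T : ℝ) :
    ∫ x in Iic T, f (x - c) = ∫ x in Iic (T - c), f x := by
  have h := (measurePreserving_sub_right volume c).setIntegral_preimage_emb
    (MeasurableEquiv.subRight c).measurableEmbedding f (Iic (T - c))
  simpa using h

/-- Functions that vanish near `-∞` and are integrable and bounded on left half-lines. -/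
structure IsTame (f : ℝ → ℝ) : Prop where
  vanish : ∃ L, ∀ x < L, f x = 0
  integrable : ∀ T, IntegrableOn f (Iic T)
  bounded : ∀ y, ∃ K, ∀ x ≤ y, |f x| ≤ K

namespace IsTame

variable {f g : ℝ → ℝ}

lemma add (hf : IsTame f) (hg : IsTame g) : IsTame fun x => f x + g x where
  vanish := by
    obtain ⟨L, hL⟩ := hf.vanish
    obtain ⟨L', hL'⟩ := hg.vanish
    refine ⟨min L L', fun x hx => ?_⟩
    rw [hL x (hx.trans_le (min_le_left _ _)), hL' x (hx.trans_le (min_le_right _ _)), add_zero]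
  integrable T := (hf.integrable T).add (hg.integrable T)
  bounded y := by
    obtain ⟨K, hK⟩ := hf.bounded y
    obtain ⟨K', hK'⟩ := hg.bounded y
    exact ⟨K + K', fun x hx => (abs_add_le _ _).trans (add_le_add (hK x hx) (hK' x hx))⟩

lemma const_mul (c : ℝ) (hf : IsTame f) : IsTame fun x => c * f x where
  vanish := hf.vanish.imp fun L hL x hx => by rw [hL x hx, mul_zero]
  integrable T := (hf.integrable T).const_mul c
  bounded y := by
    obtain ⟨K, hK⟩ := hf.bounded y
    exact ⟨|c| * K, fun x hx => by rw [abs_mul]; gcongr; exact hK x hx⟩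

lemma sub (hf : IsTame f) (hg : IsTame g) : IsTame fun x => f x - g x := by
  simpa [sub_eq_add_neg] using hf.add (hg.const_mul (-1))

lemma shift (c : ℝ) (hf : IsTame f) : IsTame fun x => f (x - c) where
  vanish := by
    obtain ⟨L, hL⟩ := hf.vanish
    exact ⟨L + c, fun x hx => hL _ (by linarith)⟩
  integrable T := by
    have h := ((measurePreserving_sub_right volume c).integrableOn_comp_preimage
      (MeasurableEquiv.subRight c).measurableEmbedding (s := Iic (T - c))).2 (hf.integrable (T - c))
    simpa [Function.comp_def] using h
  bounded y := by
    obtain ⟨K, hK⟩ := hf.bounded (y - c)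
    exact ⟨K, fun x hx => hK _ (by linarith)⟩

lemma abs_setIntegral_le (hf : IsTame f) {T y : ℝ} (h : T ≤ y) :
    |∫ x in Iic T, f x| ≤ ∫ x in Iic y, |f x| :=
  abs_integral_le_integral_abs.trans <|
    setIntegral_mono_set (hf.integrable y).abs (ae_of_all _ fun _ => abs_nonneg _)
      (Iic_subset_Iic.2 h).eventuallyLE

lemma of_monotone (hf : Monotone f) (hL : ∃ L, ∀ x < L, f x = 0) : IsTame f where
  vanish := hL
  integrable T := by
    obtain ⟨L, hL⟩ := hL
    have hIcc : IntegrableOn f (Icc (L - 1) T) :=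
      (hf.monotoneOn _).integrableOn_isCompact isCompact_Icc
    have hIio : IntegrableOn f (Iio L) :=
      (integrableOn_congr_fun (fun x hx => hL x hx) measurableSet_Iio).2 integrableOn_zero
    refine (hIio.union hIcc).mono_set fun x hx => (lt_or_ge x L).imp id fun h => ?_
    exact ⟨by linarith, hx⟩
  bounded y := by
    obtain ⟨L, hL⟩ := hL
    refine ⟨f y, fun x hx => ?_⟩
    have hzero : f (min x (L - 1)) = 0 := hL _ (by linarith [min_le_right x (L - 1)])
    rw [abs_of_nonneg (hzero ▸ hf (min_le_left _ _))]
    exact hf hx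

end IsTame

/-- `f` is tame, `f x = α x ^ s + O(s x ^ (s - 1))`, and the primitive of `f` vanishing near `-∞`
is `α / (s + 1) T ^ (s + 1) + β T ^ s + o(T ^ s)`. -/
structure HasExpansion (s : ℕ) (f : ℝ → ℝ) (α β : ℝ) : Prop where
  tame : IsTame f
  approx : (fun x => f x - α * x ^ s) =O[atTop] powDeriv s
  average : (fun T => (∫ x in Iic T, f x) - (α / (s + 1) * T ^ (s + 1) + β * T ^ s)) =o[atTop]
    fun T : ℝ => T ^ s

namespace HasExpansion

variable {f g : ℝ → ℝ} {s : ℕ} {α β α' β' : ℝ}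

lemma zero (s : ℕ) : HasExpansion s (fun _ => 0) 0 0 where
  tame := ⟨⟨0, fun _ _ => rfl⟩, fun _ => integrableOn_zero, fun _ => ⟨0, fun _ _ => by simp⟩⟩
  approx := by simpa using isBigO_zero _ _
  average := by simp

lemma add (hf : HasExpansion s f α β) (hg : HasExpansion s g α' β') :
    HasExpansion s (fun x => f x + g x) (α + α') (β + β') where
  tame := hf.tame.add hg.tame
  approx := (hf.approx.add hg.approx).congr_left fun x => by ring
  average := by
    refine (hf.average.add hg.average).congr_left fun T => ?_
    rw [integral_add (hf.tame.integrable T) (hg.tame.integrable T)]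
    ring

lemma const_mul (c : ℝ) (hf : HasExpansion s f α β) :
    HasExpansion s (fun x => c * f x) (c * α) (c * β) where
  tame := hf.tame.const_mul c
  approx := (hf.approx.const_mul_left c).congr_left fun x => by ring
  average := by
    refine (hf.average.const_mul_left c).congr_left fun T => ?_
    rw [integral_const_mul]
    ring

lemma sub (hf : HasExpansion s f α β) (hg : HasExpansion s g α' β') :
    HasExpansion s (fun x => f x - g x) (α - α') (β - β') := by
  simpa [sub_eq_add_neg] using hf.add (hg.const_mul (-1))

lemma sum {ι : Type*} {t : Finset ι} {f : ι → ℝ → ℝ} {α β : ι → ℝ}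
    (h : ∀ i ∈ t, HasExpansion s (f i) (α i) (β i)) :
    HasExpansion s (fun x => ∑ i ∈ t, f i x) (∑ i ∈ t, α i) (∑ i ∈ t, β i) := by
  classical
  induction t using Finset.induction_on with
  | empty => simpa using zero s
  | insert i t hi ih =>
    simp only [Finset.sum_insert hi]
    exact (h i (by simp)).add (ih fun j hj => h j (by simp [hj]))

lemma shift (c : ℝ) (hf : HasExpansion s f α β) :
    HasExpansion s (fun x => f (x - c)) α (β - c * α) where
  tame := hf.tame.shift c
  approx := by
    have happrox := (hf.approx.comp_tendsto (tendsto_atTop_add_const_right _ (-c) tendsto_id)).trans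
      (powDeriv_sub_const_isBigO c s)
    refine (happrox.sub ((pow_sub_shift_isBigO_powDeriv c s).const_mul_left α)).congr_left
      fun x => ?_
    simp only [Function.comp_apply, id, ← sub_eq_add_neg]
    ring
  average := by
    have haverage := (hf.average.comp_tendsto
      (tendsto_atTop_add_const_right _ (-c) tendsto_id)).trans_isBigO (sub_const_pow_isBigO_pow c s)
    have hfirst := ((pow_succ_sub_shift_isBigO_powDeriv c s).trans_isLittleO
      (powDeriv_isLittleO_pow s)).const_mul_left (α / (s + 1))
    have hsecond := ((pow_sub_shift_isBigO_powDeriv c s).trans_isLittleO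
      (powDeriv_isLittleO_pow s)).const_mul_left β
    refine ((haverage.sub hfirst).sub hsecond).congr_left fun T => ?_
    have hs : (s : ℝ) + 1 ≠ 0 := by positivity
    simp only [Function.comp_apply, id, ← sub_eq_add_neg]
    rw [setIntegral_Iic_comp_sub_right]
    field_simp
    ring

lemma raise (hf : HasExpansion s f α β) : HasExpansion (s + 1) f 0 (α / (s + 1)) where
  tame := hf.tame
  approx := by
    have herr := (hf.approx.trans_isLittleO (powDeriv_isLittleO_pow s)).isBigO.trans
      (pow_isBigO_powDeriv_succ s)
    exact (herr.add (const_mul_pow_isBigO_powDeriv_succ α s)).congr_left fun x => by ring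
  average := by
    have hlt : (fun x : ℝ => x ^ s) =o[atTop] fun x : ℝ => x ^ (s + 1) :=
      isLittleO_pow_pow_atTop_of_lt s.lt_succ_self
    refine ((hf.average.trans hlt).add (hlt.const_mul_left β)).congr_left fun T => ?_
    ring

lemma tendsto_div_pow (hf : HasExpansion s f α β) :
    Tendsto (fun x => f x / x ^ s) atTop (𝓝 α) := by
  have h := ((hf.approx.trans_isLittleO
    (powDeriv_isLittleO_pow s)).tendsto_div_nhds_zero).add_const α
  rw [zero_add] at h
  refine h.congr' ((eventually_gt_atTop 0).mono fun x hx => ?_)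
  have hxs : x ^ s ≠ 0 := (pow_pos hx s).ne'
  field_simp
  ring

lemma indicator_Ici : HasExpansion 0 ((Ici 0).indicator 1) 1 0 where
  tame := by
    refine IsTame.of_monotone (fun x y hxy => ?_) ⟨0, fun x hx => by simp [hx]⟩
    by_cases hx : 0 ≤ x
    · simp [hx, hx.trans hxy]
    · simpa [hx] using indicator_nonneg (f := 1) (s := Ici (0 : ℝ)) (fun _ _ => zero_le_one) y
  approx := by
    refine (EventuallyEq.isBigO ?_).trans (isBigO_zero _ _)
    filter_upwards [eventually_ge_atTop 0] with x hx
    simp [hx]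
  average := by
    refine (EventuallyEq.isBigO ?_).trans_isLittleO (isLittleO_zero _ _)
    filter_upwards [eventually_ge_atTop 0] with T hT
    rw [setIntegral_indicator measurableSet_Ici, inter_comm, Ici_inter_Iic]
    simp [hT]

end HasExpansion

/-- The coefficient of `x ^ s` in an expansion of `f` of order `s`. -/
def leadCoeff (s : ℕ) (f : ℝ → ℝ) : ℝ := limUnder atTop fun x => f x / x ^ s

lemma HasExpansion.leadCoeff_eq {f : ℝ → ℝ} {s : ℕ} {α β : ℝ} (hf : HasExpansion s f α β) :
    leadCoeff s f = α :=
  hf.tendsto_div_pow.limUnder_eq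

/-- The functions that have an expansion of order `s`. -/
def Expandable (s : ℕ) (f : ℝ → ℝ) : Prop := ∃ α β, HasExpansion s f α β

namespace Expandable

variable {f g : ℝ → ℝ} {s t : ℕ}

lemma zero (s : ℕ) : Expandable s fun _ => 0 := ⟨0, 0, HasExpansion.zero s⟩

lemma add (hf : Expandable s f) (hg : Expandable s g) : Expandable s fun x => f x + g x :=
  let ⟨_, _, hf⟩ := hf
  let ⟨_, _, hg⟩ := hg
  ⟨_, _, hf.add hg⟩

lemma shift (c : ℝ) (hf : Expandable s f) : Expandable s fun x => f (x - c) :=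
  let ⟨_, _, hf⟩ := hf
  ⟨_, _, hf.shift c⟩

lemma hasExpansion_succ (hf : Expandable s f) :
    HasExpansion (s + 1) f 0 (leadCoeff s f / (s + 1)) := by
  obtain ⟨α, β, hf⟩ := hf
  rw [hf.leadCoeff_eq]
  exact hf.raise

lemma mono (hf : Expandable s f) (hst : s ≤ t) : Expandable t f := by
  induction hst with
  | refl => exact hf
  | step _ ih => exact ⟨_, _, ih.hasExpansion_succ⟩

lemma hasExpansion_zero_of_lt (hf : Expandable s f) (hst : s < t) :
    ∃ β, HasExpansion t f 0 β := by
  obtain ⟨t, rfl⟩ := Nat.exists_eq_add_of_lt hst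
  exact ⟨_, (hf.mono (Nat.le_add_right s t)).hasExpansion_succ⟩

lemma leadCoeff_add (hf : Expandable s f) (hg : Expandable s g) :
    leadCoeff s (fun x => f x + g x) = leadCoeff s f + leadCoeff s g := by
  obtain ⟨α, β, hf⟩ := hf
  obtain ⟨α', β', hg⟩ := hg
  rw [(hf.add hg).leadCoeff_eq, hf.leadCoeff_eq, hg.leadCoeff_eq]

lemma leadCoeff_shift (c : ℝ) (hf : Expandable s f) :
    leadCoeff s (fun x => f (x - c)) = leadCoeff s f := by
  obtain ⟨α, β, hf⟩ := hf
  rw [(hf.shift c).leadCoeff_eq, hf.leadCoeff_eq]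

lemma leadCoeff_le (hf : Expandable s f) (hg : Expandable s g) (hfg : ∀ x, f x ≤ g x) :
    leadCoeff s f ≤ leadCoeff s g := by
  obtain ⟨α, β, hf⟩ := hf
  obtain ⟨α', β', hg⟩ := hg
  rw [hf.leadCoeff_eq, hg.leadCoeff_eq]
  refine le_of_tendsto_of_tendsto hf.tendsto_div_pow hg.tendsto_div_pow ?_
  filter_upwards [eventually_gt_atTop 0] with x hx
  exact div_le_div_of_nonneg_right (hfg x) (pow_pos hx s).le

end Expandable

lemma exists_abs_sub_le_of_continuous {F p : ℝ → ℝ} (hF : ∀ y, ∃ K, ∀ x ≤ y, |F x| ≤ K)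
    (hp : Continuous p) (d y : ℝ) : ∃ K, ∀ x ∈ Icc (y - d) y, |F x - p x| ≤ K := by
  obtain ⟨K, hK⟩ := hF y
  obtain ⟨K', hK'⟩ := (isCompact_Icc (a := y - d) (b := y)).exists_bound_of_continuousOn
    hp.continuousOn
  exact ⟨K + K', fun x hx => (abs_sub _ _).trans (add_le_add (hK x hx.2) (hK' x hx))⟩

lemma isBigO_powDeriv_of_sub_shift {F : ℝ → ℝ} {d A : ℝ} {s : ℕ} (hd : 0 < d)
    (hF : ∀ y, ∃ K, ∀ x ≤ y, |F x| ≤ K)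
    (h : (fun x => F x - F (x - d) - A * ((s + 1) * d) * x ^ s) =O[atTop] powDeriv s) :
    (fun x => F x - A * x ^ (s + 1)) =O[atTop] powDeriv (s + 1) := by
  refine IsBigO.trans ?_ (pow_isBigO_powDeriv_succ s)
  refine isBigO_pow_of_sub_shift hd (exists_abs_sub_le_of_continuous hF (by fun_prop) d) ?_
  exact (h.sub ((pow_succ_sub_shift_isBigO_powDeriv d s).const_mul_left A)).congr_left
    fun x => by ring

lemma isLittleO_pow_of_sub_shift_sub_pow {F : ℝ → ℝ} {d A B : ℝ} {s : ℕ} (hd : 0 < d)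
    (hF : ∀ y, ∃ K, ∀ x ≤ y, |F x| ≤ K)
    (h : (fun x => F x - F (x - d) - (A * d * x ^ (s + 1) +
      (B * ((s + 1) * d) - A * (s + 1) / 2 * d ^ 2) * x ^ s)) =o[atTop] fun x => x ^ s) :
    (fun x => F x - (A / (s + 2) * x ^ (s + 2) + B * x ^ (s + 1))) =o[atTop]
      fun x => x ^ (s + 1) := by
  have hs : (s : ℝ) + 2 ≠ 0 := by positivity
  refine isLittleO_pow_of_sub_shift hd (exists_abs_sub_le_of_continuous hF (by fun_prop) d) ?_
  have hA := (pow_add_two_sub_shift_isLittleO_pow d s).const_mul_left (A / (s + 2))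
  have hB := ((pow_succ_sub_shift_isBigO_powDeriv d s).trans_isLittleO
    (powDeriv_isLittleO_pow s)).const_mul_left B
  refine ((h.sub hA).sub hB).congr_left fun x => ?_
  field_simp
  ring

lemma Expandable.of_sub_shift {f : ℝ → ℝ} {s : ℕ} {d : ℝ} (hd : 0 < d) (hf : IsTame f)
    (h : Expandable s fun x => f x - f (x - d)) : Expandable (s + 1) f := by
  obtain ⟨α, β, h⟩ := h
  have hs : (s : ℝ) + 1 ≠ 0 := by positivity
  set A : ℝ := α / ((s + 1) * d) with hA
  set B : ℝ := (β + A * (s + 1) / 2 * d ^ 2) / ((s + 1) * d) with hB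
  have hαA : A * ((s + 1) * d) = α := by rw [hA]; field_simp
  have hβB : B * ((s + 1) * d) - A * (s + 1) / 2 * d ^ 2 = β := by rw [hB]; field_simp; ring
  refine ⟨A, B, hf, isBigO_powDeriv_of_sub_shift hd hf.bounded (hαA ▸ h.approx), ?_⟩
  have hprim := isLittleO_pow_of_sub_shift_sub_pow (F := fun T => ∫ x in Iic T, f x) (A := A)
    (B := B) hd (fun y => ⟨_, fun x hx => hf.abs_setIntegral_le hx⟩)
    (h.average.congr_left fun T => by
      rw [integral_sub (hf.integrable T) ((hf.shift d).integrable T),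
        setIntegral_Iic_comp_sub_right, hβB, ← hαA]
      field_simp)
  refine hprim.congr_left fun T => ?_
  push_cast
  ring

section

variable {k M : Type*} [Field k] [AddCommGroup M] [Module k M]

lemma IsRRCoeffs.of_hasExpansion {n : ℕ} (hn : 1 ≤ n) {ℳ : ℝ → Submodule k M} {α β : ℝ}
    (hfin : ∀ x : ℝ, FiniteDimensional k (⨆ (t : ℝ) (_ : t ≤ x), ℳ t : Submodule k M))
    (h : HasExpansion n (fun x => (dimLE ℳ x : ℝ)) α β) :
    IsRRCoeffs n ℳ (n ! * α) (n ! * β) := by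
  obtain ⟨m, rfl⟩ := Nat.exists_eq_add_of_le' hn
  have hα : ((m + 1)! : ℝ) * α / ((m + 1)! : ℝ) = α := by field_simp
  have hβ : ((m + 1)! : ℝ) * β / ((m + 1 - 1)! : ℝ) = (m + 1) * β := by
    rw [Nat.add_sub_cancel, Nat.factorial_succ]
    push_cast
    field_simp
  refine ⟨hfin, ?_, ?_⟩
  · rw [hα]
    exact h.approx.trans (powDeriv_succ_isBigO_pow m)
  set c : ℝ := (∫ x in Iic 1, (dimLE ℳ x : ℝ)) - (α / (((m + 1 : ℕ) : ℝ) + 1) + β) with hc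
  have hconst : Tendsto (fun T : ℝ => c / T ^ (m + 1)) atTop (𝓝 0) :=
    tendsto_const_nhds.div_atTop (tendsto_pow_atTop m.succ_ne_zero)
  have hlim := h.average.tendsto_div_nhds_zero.sub hconst
  rw [sub_zero] at hlim
  refine hlim.congr fun T => ?_
  have hint : IntervalIntegrable (fun x => (dimLE ℳ x : ℝ)) volume 1 T :=
    ⟨(h.tame.integrable T).mono_set Ioc_subset_Iic_self,
      (h.tame.integrable 1).mono_set Ioc_subset_Iic_self⟩
  have hpow (a : ℝ) (i : ℕ) : IntervalIntegrable (fun x : ℝ => a * x ^ i) volume 1 T :=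
    Continuous.intervalIntegrable (by fun_prop) _ _
  rw [hα, hβ, intervalIntegral.integral_sub (hint.sub (hpow _ _)) (hpow _ _),
    intervalIntegral.integral_sub hint (hpow _ _), intervalIntegral.integral_const_mul,
    intervalIntegral.integral_const_mul, integral_pow, integral_pow,
    ← intervalIntegral.integral_Iic_sub_Iic (h.tame.integrable 1) (h.tame.integrable T),
    ← sub_div, one_div, inv_mul_eq_div, Nat.add_sub_cancel, hc]
  congr 1
  push_cast
  field_simp
  ring

lemma IsRRCoeffs.subCoeff_eq {n : ℕ} (hn : 1 ≤ n) {ℳ : ℝ → Submodule k M} {a b : ℝ}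
    (h : IsRRCoeffs n ℳ a b) : subCoeff n ℳ = b := by
  have hex : ∃ b a : ℝ, IsRRCoeffs n ℳ a b := ⟨b, a, h⟩
  rw [subCoeff, dif_pos hex]
  exact (hex.choose_spec.choose_spec.unique hn h).2

end

end Asymptotics

section Homogeneous

variable {ι σ τ R M : Type*}

section Semiring

variable [Semiring R] [AddCommMonoid M] [Module R M] [SetLike σ R] (𝒜 : ι → σ)
  [SetLike τ M] (ℳ : ι → τ)

lemma exists_finset_homogeneous_span_eq [Nonempty ι] (I : Set ι)
    (h : (Submodule.span R {m : M | ∃ t ∈ I, m ∈ ℳ t}).FG) :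
    ∃ (S : Finset M) (d : M → ι), (∀ g ∈ S, d g ∈ I ∧ g ∈ ℳ (d g)) ∧
      Submodule.span R S = Submodule.span R {m : M | ∃ t ∈ I, m ∈ ℳ t} := by
  obtain ⟨S, hS, hspan⟩ := (Submodule.fg_span_iff_fg_span_finset_subset _).1 h
  have hdeg : ∀ g ∈ S, ∃ t, t ∈ I ∧ g ∈ ℳ t := fun g hg => hS hg
  choose! d hd using hdeg
  exact ⟨S, d, hd, hspan.symm⟩

variable [AddSubmonoidClass τ M] [DecidableEq ι] [DirectSum.Decomposition ℳ]

lemma isHomogeneous_top : (⊤ : Submodule R M).IsHomogeneous ℳ := fun _ _ _ => trivial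

variable {ℳ} in
lemma exists_homogeneous_mem_notMem {N N' : Submodule R M} (hN : N.IsHomogeneous ℳ)
    (hN' : N'.IsHomogeneous ℳ) (h : ¬ N' ≤ N) : ∃ e, ∃ m ∈ ℳ e, m ∈ N' ∧ m ∉ N := by
  obtain ⟨m, hmN', hmN⟩ := SetLike.not_le_iff_exists.1 h
  rw [hN.mem_iff ℳ] at hmN
  push Not at hmN
  obtain ⟨e, he⟩ := hmN
  exact ⟨e, _, SetLike.coe_mem _, hN' e hmN', he⟩

lemma span_homogeneous_eq_top : Submodule.span R {m : M | ∃ t, m ∈ ℳ t} = ⊤ := by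
  classical
  refine eq_top_iff.2 fun m _ => ?_
  rw [← DirectSum.sum_support_decompose ℳ m]
  exact Submodule.sum_mem _ fun t _ => Submodule.subset_span ⟨t, SetLike.coe_mem _⟩

lemma exists_homogeneous_generators [Nonempty ι] [Module.Finite R M] :
    ∃ (S : Finset M) (d : M → ι), (∀ g ∈ S, g ∈ ℳ (d g)) ∧ Submodule.span R (S : Set M) = ⊤ := by
  have htop : Submodule.span R {m : M | ∃ t ∈ Set.univ, m ∈ ℳ t} = ⊤ := by
    simpa using span_homogeneous_eq_top (R := R) ℳ
  obtain ⟨S, d, hd, hS⟩ := exists_finset_homogeneous_span_eq (R := R) ℳ Set.univ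
    (htop ▸ Module.Finite.fg_top)
  exact ⟨S, d, fun g hg => (hd g hg).2, hS.trans htop⟩

variable [AddCommGroup ι] [AddSubmonoidClass σ R] [GradedRing 𝒜] [SetLike.GradedSMul 𝒜 ℳ]

lemma decompose_smul_of_mem (t : ι) {e : ι} {m : M} (hm : m ∈ ℳ e) (r : R) :
    (DirectSum.decompose ℳ (r • m) t : M) = (DirectSum.decompose 𝒜 r (t - e) : R) • m := by
  induction r using DirectSum.Decomposition.inductionOn 𝒜 with
  | zero => simp
  | add r s hr hs => simp only [add_smul, DirectSum.decompose_add, DirectSum.add_apply,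
      AddMemClass.coe_add, hr, hs]
  | @homogeneous i r =>
    have h : (r : R) • m ∈ ℳ (i + e) := SetLike.GradedSMul.smul_mem r.2 hm
    obtain rfl | hit := eq_or_ne (i + e) t
    · rw [DirectSum.decompose_of_mem_same ℳ h, add_sub_cancel_right,
        DirectSum.decompose_of_mem_same 𝒜 r.2]
    · rw [DirectSum.decompose_of_mem_ne ℳ h hit,
        DirectSum.decompose_of_mem_ne 𝒜 r.2 (fun h => hit (eq_sub_iff_add_eq.1 h)), zero_smul]

include 𝒜 in
lemma isHomogeneous_span {s : Set M} (hs : ∀ m ∈ s, ∃ e, m ∈ ℳ e) :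
    (Submodule.span R s).IsHomogeneous ℳ := by
  intro t y hy
  obtain ⟨c, hc, rfl⟩ := Submodule.mem_span_set.1 hy
  rw [Finsupp.sum, DirectSum.decompose_sum, DFinsupp.finsetSum_apply,
    AddSubmonoidClass.coe_finsetSum]
  refine Submodule.sum_mem _ fun m hm => ?_
  obtain ⟨e, he⟩ := hs m (hc hm)
  rw [decompose_smul_of_mem 𝒜 ℳ t he]
  exact Submodule.smul_mem _ _ (Submodule.subset_span (hc hm))

include 𝒜 in
lemma isHomogeneous_sup_span_singleton {N : Submodule R M} (hN : N.IsHomogeneous ℳ) {e : ι}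
    {m : M} (hm : m ∈ ℳ e) : (N ⊔ Submodule.span R {m}).IsHomogeneous ℳ := by
  intro t y hy
  obtain ⟨n, hn, z, hz, rfl⟩ := Submodule.mem_sup.1 hy
  rw [DirectSum.decompose_add, DirectSum.add_apply, AddMemClass.coe_add]
  exact Submodule.add_mem_sup (hN t hn)
    (isHomogeneous_span 𝒜 ℳ (fun _ hx => ⟨e, Set.mem_singleton_iff.1 hx ▸ hm⟩) t hz)

lemma exists_homogeneous_coeffs {S : Finset M} {d : M → ι} (hd : ∀ g ∈ S, g ∈ ℳ (d g))
    {t : ι} {m : M} (hm : m ∈ ℳ t) (hmS : m ∈ Submodule.span R (S : Set M)) :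
    ∃ c : M → R, (∀ g, c g ∈ 𝒜 (t - d g)) ∧ m = ∑ g ∈ S, c g • g := by
  obtain ⟨c, -, rfl⟩ := Submodule.mem_span_finset.1 hmS
  refine ⟨fun g => DirectSum.decompose 𝒜 (c g) (t - d g), fun g => SetLike.coe_mem _, ?_⟩
  conv_lhs => rw [← DirectSum.decompose_of_mem_same ℳ hm]
  rw [DirectSum.decompose_sum, DFinsupp.finsetSum_apply, AddSubmonoidClass.coe_finsetSum]
  exact Finset.sum_congr rfl fun g hg => decompose_smul_of_mem 𝒜 ℳ t (hd g hg) _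

variable {ℳ} in
lemma isHomogeneous_colon {N : Submodule R M} (hN : N.IsHomogeneous ℳ) {s : Set M}
    (hs : ∀ m ∈ s, ∃ e, m ∈ ℳ e) : (N.colon s).IsHomogeneous 𝒜 := by
  intro t r hr
  rw [Submodule.mem_colon] at hr ⊢
  intro m hm
  obtain ⟨e, he⟩ := hs m hm
  have h := hN (t + e) (hr m hm)
  rwa [decompose_smul_of_mem 𝒜 ℳ _ he, add_sub_cancel_right] at h

variable {ℳ} in
lemma isHomogeneous_colon_singleton {N : Submodule R M} (hN : N.IsHomogeneous ℳ) {e : ι} {m : M}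
    (hm : m ∈ ℳ e) : (N.colon {m}).IsHomogeneous 𝒜 :=
  isHomogeneous_colon 𝒜 hN fun _ hx => ⟨e, Set.mem_singleton_iff.1 hx ▸ hm⟩

variable {ℳ} in
lemma isHomogeneous_colon_coe {N N' : Submodule R M}
    (hN : N.IsHomogeneous ℳ) (hN' : N'.IsHomogeneous ℳ) :
    (N.colon (N' : Set M)).IsHomogeneous 𝒜 := by
  classical
  intro t r hr
  refine Submodule.mem_colon.2 fun m hm => ?_
  rw [← DirectSum.sum_support_decompose ℳ m, Finset.smul_sum]
  exact N.sum_mem fun i _ => Submodule.mem_colon_singleton.1 (isHomogeneous_colon_singleton 𝒜 hN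
    (SetLike.coe_mem _) t (Submodule.mem_colon_singleton.2 (Submodule.mem_colon.1 hr _ (hN' i hm))))

end Semiring

section CommRing

variable [AddCommGroup ι] [LinearOrder ι] [IsOrderedAddMonoid ι]
  [CommRing R] [AddCommMonoid M] [Module R M] [SetLike σ R] [AddSubmonoidClass σ R]
  [SetLike τ M] [AddSubmonoidClass τ M]
  (𝒜 : ι → σ) [GradedRing 𝒜] {ℳ : ι → τ} [DirectSum.Decomposition ℳ] [SetLike.GradedSMul 𝒜 ℳ]

include 𝒜

lemma exists_isPrime_colon [IsNoetherianRing R] {N N' : Submodule R M}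
    (hN : N.IsHomogeneous ℳ) (hN' : N'.IsHomogeneous ℳ) (h : ¬ N' ≤ N) :
    ∃ e, ∃ m ∈ ℳ e, m ∈ N' ∧ m ∉ N ∧ (N.colon {m}).IsPrime := by
  let colons : Set (Ideal R) := {J | ∃ e, ∃ m ∈ ℳ e, m ∈ N' ∧ m ∉ N ∧ N.colon {m} = J}
  have hne : colons.Nonempty :=
    let ⟨e, m, hm, hmN', hmN⟩ := exists_homogeneous_mem_notMem hN hN' h
    ⟨_, e, m, hm, hmN', hmN, rfl⟩
  obtain ⟨_, ⟨e, m, hm, hmN', hmN, rfl⟩, hmax⟩ :=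
    set_has_maximal_iff_noetherian.2 ‹IsNoetherianRing R› colons hne
  refine ⟨e, m, hm, hmN', hmN,
    (isHomogeneous_colon_singleton 𝒜 hN hm).isPrime_of_homogeneous_mem_or_mem (by simpa) ?_⟩
  rintro a b - ⟨i, hb⟩ hab
  by_contra! hcon
  obtain ⟨ha, hbm⟩ := hcon
  simp only [Submodule.mem_colon_singleton] at hab ha hbm
  have hle : N.colon {m} ≤ N.colon {b • m} := fun r hr => by
    rw [Submodule.mem_colon_singleton] at hr ⊢
    exact smul_comm r b m ▸ N.smul_mem b hr
  have heq : N.colon {m} = N.colon {b • m} := hle.eq_of_not_lt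
    (hmax _ ⟨_, _, SetLike.GradedSMul.smul_mem hb hm, N'.smul_mem b hmN', hbm, rfl⟩)
  refine ha (Submodule.mem_colon_singleton.1 (heq ▸ Submodule.mem_colon_singleton.2 ?_))
  rwa [smul_smul]

lemma homogeneous_induction [IsNoetherianRing R] [IsNoetherian R M] {N' : Submodule R M}
    (hN' : N'.IsHomogeneous ℳ) {C : Submodule R M → Prop} (top : C N')
    (step : ∀ N ≤ N', N.IsHomogeneous ℳ → ∀ e, ∀ m ∈ ℳ e, m ∈ N' → (N.colon {m}).IsPrime →
      C (N ⊔ Submodule.span R {m}) → C N)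
    (N : Submodule R M) (hle : N ≤ N') (hN : N.IsHomogeneous ℳ) : C N := by
  induction N using WellFoundedGT.induction with
  | ind N ih =>
    by_cases h : N' ≤ N
    · rwa [le_antisymm hle h]
    obtain ⟨e, m, hm, hmN', hmN, hp⟩ := exists_isPrime_colon 𝒜 hN hN' h
    refine step N hle hN e m hm hmN' hp (ih _ ?_ ?_ ?_)
    · exact left_lt_sup.2 fun h => hmN (h (Submodule.mem_span_singleton_self m))
    · exact sup_le hle ((Submodule.span_singleton_le_iff_mem _ _).2 hmN')
    · exact isHomogeneous_sup_span_singleton 𝒜 ℳ hN hm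

end CommRing

end Homogeneous

section Rank

variable {k V W : Type*} [Field k] [AddCommGroup V] [Module k V] [AddCommGroup W] [Module k W]
  (T : V →ₗ[k] W)

lemma finrank_map_add_finrank_inf_ker (B : Submodule k V) [FiniteDimensional k B] :
    Module.finrank k (B.map T) + Module.finrank k (B ⊓ LinearMap.ker T : Submodule k V) =
      Module.finrank k B := by
  rw [← LinearMap.finrank_range_add_finrank_ker (T.domRestrict B), LinearMap.range_domRestrict,
    LinearMap.ker_domRestrict, (Submodule.equivSubtypeMap B _).finrank_eq,
    Submodule.map_comap_subtype]

lemma finrank_map_sup_add_finrank_inf_comap (B : Submodule k V) (A : Submodule k W)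
    [FiniteDimensional k B] [FiniteDimensional k A] :
    Module.finrank k (B.map T ⊔ A : Submodule k W) +
      Module.finrank k (B ⊓ A.comap T : Submodule k V) =
      Module.finrank k B + Module.finrank k A := by
  have hmap : (B ⊓ A.comap T).map T = B.map T ⊓ A := Submodule.map_inf_eq_map_inf_comap.symm
  have hker : B ⊓ A.comap T ⊓ LinearMap.ker T = B ⊓ LinearMap.ker T := by
    rw [inf_assoc, inf_eq_right.2 (LinearMap.ker_le_comap T)]
  have hsup := Submodule.finrank_sup_add_finrank_inf_eq (B.map T) A
  have hB := finrank_map_add_finrank_inf_ker T B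
  have hBA := finrank_map_add_finrank_inf_ker T (B ⊓ A.comap T)
  rw [hmap, hker] at hBA
  omega

end Rank

section HilbertFunction

variable {k R M : Type*} [Field k] [CommRing R] [Algebra k R] [AddCommGroup M] [Module k M]

/-- The subspace `M_{≤ x}` of elements all of whose components have degree at most `x`. -/
def gradedLE (ℳ : ℝ → Submodule k M) (x : ℝ) : Submodule k M :=
  ⨆ (t : ℝ) (_ : t ≤ x), ℳ t

variable (𝒜 : ℝ → Submodule k R) (ℳ : ℝ → Submodule k M)

variable {ℳ} in
lemma gradedLE_le_iff {x : ℝ} {V : Submodule k M} : gradedLE ℳ x ≤ V ↔ ∀ t ≤ x, ℳ t ≤ V :=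
  iSup₂_le_iff

lemma le_gradedLE {t x : ℝ} (h : t ≤ x) : ℳ t ≤ gradedLE ℳ x :=
  le_iSup₂_of_le t h le_rfl

lemma gradedLE_mono : Monotone (gradedLE ℳ) := fun _ _ hxy =>
  gradedLE_le_iff.2 fun _ ht => le_gradedLE ℳ (ht.trans hxy)

variable {ℳ} in
lemma gradedLE_eq_bot {L x : ℝ} (hL : ∀ t < L, ℳ t = ⊥) (hx : x < L) : gradedLE ℳ x = ⊥ :=
  eq_bot_iff.2 (gradedLE_le_iff.2 fun t ht => (hL t (ht.trans_lt hx)).le)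

section Truncate

variable [DirectSum.Decomposition ℳ]

/-- The projection of `M` onto `M_{≤ x}` that discards the components of degree above `x`. -/
def truncate (x : ℝ) : M →ₗ[k] M :=
  (DirectSum.toModule k ℝ M fun t => if t ≤ x then (ℳ t).subtype else 0) ∘ₗ
    (DirectSum.decomposeLinearEquiv ℳ).toLinearMap

lemma truncate_of_mem (x : ℝ) {t : ℝ} {m : M} (hm : m ∈ ℳ t) :
    truncate ℳ x m = if t ≤ x then m else 0 := by
  simp only [truncate, LinearMap.comp_apply, LinearEquiv.coe_coe,
    DirectSum.decomposeLinearEquiv_apply, DirectSum.decompose_of_mem ℳ hm]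
  erw [DirectSum.toModule_lof]
  split_ifs <;> simp

lemma truncate_eq_self {x : ℝ} {m : M} (hm : m ∈ gradedLE ℳ x) : truncate ℳ x m = m := by
  have hle : gradedLE ℳ x ≤ LinearMap.eqLocus (truncate ℳ x) LinearMap.id :=
    gradedLE_le_iff.2 fun t ht m hm => by
      simp [LinearMap.mem_eqLocus, truncate_of_mem ℳ x hm, ht]
  exact hle hm

lemma truncate_mem_of_components {S : Submodule k M} (x : ℝ) {m : M}
    (h : ∀ t ≤ x, (DirectSum.decompose ℳ m t : M) ∈ S) : truncate ℳ x m ∈ S := by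
  classical
  rw [← DirectSum.sum_support_decompose ℳ m, map_sum]
  refine Submodule.sum_mem _ fun t _ => ?_
  rw [truncate_of_mem ℳ x (SetLike.coe_mem _)]
  split_ifs with ht
  · exact h t ht
  · exact zero_mem _

lemma truncate_mem_gradedLE (x : ℝ) (m : M) : truncate ℳ x m ∈ gradedLE ℳ x :=
  truncate_mem_of_components ℳ x fun _ ht => le_gradedLE ℳ ht (SetLike.coe_mem _)

end Truncate

section Module

variable [Module R M]

section GradedSMul

variable [GradedAlgebra 𝒜] [DirectSum.Decomposition ℳ] [SetLike.GradedSMul 𝒜 ℳ]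

lemma truncate_smul (x : ℝ) {e : ℝ} {m : M} (hm : m ∈ ℳ e) (r : R) :
    truncate ℳ x (r • m) = truncate 𝒜 (x - e) r • m := by
  induction r using DirectSum.Decomposition.inductionOn 𝒜 with
  | zero => simp
  | add r s hr hs => simp only [add_smul, map_add, hr, hs]
  | @homogeneous i r =>
    have h : (r : R) • m ∈ ℳ (i + e) := SetLike.GradedSMul.smul_mem r.2 hm
    rw [truncate_of_mem ℳ x h, truncate_of_mem 𝒜 _ r.2]
    simp only [le_sub_iff_add_le]
    split_ifs <;> simp

lemma smul_mem_gradedLE {x e : ℝ} {m : M} (hm : m ∈ ℳ e) {r : R} (hr : r ∈ gradedLE 𝒜 (x - e)) :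
    r • m ∈ gradedLE ℳ x := by
  rw [← truncate_eq_self 𝒜 hr, ← truncate_smul 𝒜 ℳ x hm]
  exact truncate_mem_gradedLE ℳ x _

end GradedSMul

variable [IsScalarTower k R M]

/-- The subspace `N ∩ M_{≤ x}` of a submodule `N` of `M`. -/
abbrev truncLE (N : Submodule R M) (x : ℝ) : Submodule k M :=
  N.restrictScalars k ⊓ gradedLE ℳ x

/-- The Hilbert function `x ↦ dim_k (N ∩ M_{≤ x})` of a submodule `N` of `M`, with values in `ℝ`. -/
def hilb (N : Submodule R M) (x : ℝ) : ℝ :=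
  Module.finrank k (truncLE ℳ N x)

/-- The Hilbert function of the quotient `N' / N` for submodules `N ≤ N'` of `M`. -/
def quotHilb (N N' : Submodule R M) (x : ℝ) : ℝ :=
  hilb ℳ N' x - hilb ℳ N x

lemma truncLE_top (x : ℝ) : truncLE ℳ (⊤ : Submodule R M) x = gradedLE ℳ x := by
  rw [truncLE, Submodule.restrictScalars_top, top_inf_eq]

lemma hilb_top : hilb ℳ (⊤ : Submodule R M) = fun x => (dimLE ℳ x : ℝ) := by
  ext x
  rw [hilb, truncLE_top, gradedLE, dimLE]

lemma hilb_bot : hilb ℳ (⊥ : Submodule R M) = 0 := by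
  funext x
  rw [hilb, truncLE, Submodule.restrictScalars_bot, bot_inf_eq, finrank_bot, Nat.cast_zero,
    Pi.zero_apply]

variable {ℳ} in
lemma hilb_eq_zero {L x : ℝ} (hL : ∀ t < L, ℳ t = ⊥) (hx : x < L) (N : Submodule R M) :
    hilb ℳ N x = 0 := by
  rw [hilb, truncLE, gradedLE_eq_bot hL hx, inf_bot_eq, finrank_bot, Nat.cast_zero]

lemma quotHilb_self (N : Submodule R M) : quotHilb ℳ N N = 0 :=
  funext fun _ => sub_self _

lemma quotHilb_add_quotHilb (N N' N'' : Submodule R M) :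
    (fun x => quotHilb ℳ N N' x + quotHilb ℳ N' N'' x) = quotHilb ℳ N N'' :=
  funext fun _ => sub_add_sub_cancel' _ _ _

section FiniteDimensional

variable [∀ x, FiniteDimensional k (gradedLE ℳ x)]

lemma hilb_mono_left {N N' : Submodule R M} (h : N ≤ N') (x : ℝ) : hilb ℳ N x ≤ hilb ℳ N' x :=
  Nat.cast_le.2 (Submodule.finrank_mono (inf_le_inf_right (gradedLE ℳ x)
    (Submodule.restrictScalars_mono (S := k) h)))

lemma isTame_hilb (N : Submodule R M) (hL : ∃ L, ∀ t < L, ℳ t = ⊥) : IsTame (hilb ℳ N) := by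
  refine IsTame.of_monotone (fun x y hxy => ?_) ?_
  · exact Nat.cast_le.2 (Submodule.finrank_mono (inf_le_inf_left _ (gradedLE_mono ℳ hxy)))
  · obtain ⟨L, hL⟩ := hL
    exact ⟨L, fun x hx => hilb_eq_zero hL hx N⟩

lemma isTame_quotHilb (N N' : Submodule R M) (hL : ∃ L, ∀ t < L, ℳ t = ⊥) :
    IsTame (quotHilb ℳ N N') :=
  (isTame_hilb ℳ N' hL).sub (isTame_hilb ℳ N hL)

end FiniteDimensional

section Graded

variable [GradedAlgebra 𝒜] [DirectSum.Decomposition ℳ] [SetLike.GradedSMul 𝒜 ℳ]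

lemma map_toSpanSingleton_sup_truncLE {N : Submodule R M} (hN : N.IsHomogeneous ℳ) {e : ℝ} {m : M}
    (hm : m ∈ ℳ e) (x : ℝ) :
    (gradedLE 𝒜 (x - e)).map ((LinearMap.toSpanSingleton R M m).restrictScalars k) ⊔
      truncLE ℳ N x = truncLE ℳ (N ⊔ Submodule.span R {m}) x := by
  apply le_antisymm
  · refine sup_le ?_ (inf_le_inf_right _ fun y hy => Submodule.mem_sup_left hy)
    rintro _ ⟨r, hr, rfl⟩
    exact ⟨Submodule.mem_sup_right (Submodule.mem_span_singleton.2 ⟨r, rfl⟩),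
      smul_mem_gradedLE 𝒜 ℳ hm hr⟩
  · rintro y ⟨hy, hyx⟩
    obtain ⟨n, hn, z, hz, rfl⟩ := Submodule.mem_sup.1 hy
    obtain ⟨r, rfl⟩ := Submodule.mem_span_singleton.1 hz
    rw [← truncate_eq_self ℳ hyx, map_add, truncate_smul 𝒜 ℳ x hm, add_comm]
    have htn : truncate ℳ x n ∈ N.restrictScalars k :=
      truncate_mem_of_components ℳ x fun t _ => hN t hn
    exact Submodule.add_mem_sup ⟨_, truncate_mem_gradedLE 𝒜 _ r, rfl⟩
      ⟨htn, truncate_mem_gradedLE ℳ x n⟩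

lemma gradedLE_inf_comap_toSpanSingleton (N : Submodule R M) {e : ℝ} {m : M} (hm : m ∈ ℳ e)
    (x : ℝ) :
    gradedLE 𝒜 (x - e) ⊓
        (truncLE ℳ N x).comap ((LinearMap.toSpanSingleton R M m).restrictScalars k) =
      truncLE 𝒜 (N.colon {m}) (x - e) := by
  ext r
  constructor
  · rintro ⟨hr, hrN, -⟩
    exact ⟨Submodule.mem_colon_singleton.2 hrN, hr⟩
  · rintro ⟨hrN, hr⟩
    exact ⟨hr, Submodule.mem_colon_singleton.1 hrN, smul_mem_gradedLE 𝒜 ℳ hm hr⟩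

lemma quotHilb_sup_span_singleton [∀ x, FiniteDimensional k (gradedLE 𝒜 x)]
    [∀ x, FiniteDimensional k (gradedLE ℳ x)] {N : Submodule R M} (hN : N.IsHomogeneous ℳ)
    {e : ℝ} {m : M} (hm : m ∈ ℳ e) :
    quotHilb ℳ N (N ⊔ Submodule.span R {m}) = fun x => quotHilb 𝒜 (N.colon {m}) ⊤ (x - e) := by
  funext x
  have h := finrank_map_sup_add_finrank_inf_comap
    ((LinearMap.toSpanSingleton R M m).restrictScalars k) (gradedLE 𝒜 (x - e)) (truncLE ℳ N x)
  rw [map_toSpanSingleton_sup_truncLE 𝒜 ℳ hN hm, gradedLE_inf_comap_toSpanSingleton 𝒜 ℳ N hm,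
    ← truncLE_top (R := R) 𝒜] at h
  simp only [quotHilb, hilb]
  rw [sub_eq_sub_iff_add_eq_add, add_comm (Module.finrank k (truncLE 𝒜 ⊤ (x - e)) : ℝ)]
  exact_mod_cast h.trans (add_comm _ _)

lemma mem_iSup_map_toSpanSingleton {S : Finset M} {d : M → ℝ} (hd : ∀ g ∈ S, g ∈ ℳ (d g))
    {t x : ℝ} (htx : t ≤ x) {m : M} (hm : m ∈ ℳ t) (hmS : m ∈ Submodule.span R (S : Set M)) :
    m ∈ ⨆ g : S, (gradedLE 𝒜 (x - d g)).map
      ((LinearMap.toSpanSingleton R M (g : M)).restrictScalars k) := by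
  obtain ⟨c, hc, rfl⟩ := exists_homogeneous_coeffs 𝒜 ℳ hd hm hmS
  refine Submodule.sum_mem _ fun g hg => Submodule.mem_iSup_of_mem ⟨g, hg⟩ ?_
  exact ⟨c g, le_gradedLE 𝒜 (sub_le_sub_right htx _) (hc g), rfl⟩

lemma finiteDimensional_gradedLE [Module.Finite R M] [∀ x, FiniteDimensional k (gradedLE 𝒜 x)]
    (x : ℝ) : FiniteDimensional k (gradedLE ℳ x) := by
  obtain ⟨S, d, hd, hS⟩ := exists_homogeneous_generators (R := R) ℳ
  exact Submodule.finiteDimensional_of_le (gradedLE_le_iff.2 fun t ht m hm =>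
    mem_iSup_map_toSpanSingleton 𝒜 ℳ hd ht hm (hS ▸ Submodule.mem_top))

end Graded

end Module

section Connected

variable (hneg : ∀ t < 0, 𝒜 t = ⊥) (hzero : ∀ r ∈ 𝒜 0, ∃ c : k, algebraMap k R c = r)

include hneg hzero

lemma gradedLE_le_span_one_sup {x : ℝ} {C : Submodule k R} (hC : ∀ t, 0 < t → t ≤ x → 𝒜 t ≤ C) :
    gradedLE 𝒜 x ≤ Submodule.span k {1} ⊔ C := by
  refine gradedLE_le_iff.2 fun t htx r hr => ?_
  rcases lt_trichotomy t 0 with ht | rfl | ht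
  · rw [hneg t ht, Submodule.mem_bot] at hr
    exact hr ▸ zero_mem _
  · obtain ⟨c, rfl⟩ := hzero r hr
    exact Submodule.mem_sup_left
      (Submodule.mem_span_singleton.2 ⟨c, (Algebra.algebraMap_eq_smul_one c).symm⟩)
  · exact Submodule.mem_sup_right (hC t ht htx hr)

lemma finiteDimensional_gradedLE_self [GradedAlgebra 𝒜] [IsNoetherianRing R] (x : ℝ) :
    FiniteDimensional k (gradedLE 𝒜 x) := by
  obtain ⟨S, d, hd, hS⟩ := exists_finset_homogeneous_span_eq 𝒜 (Set.Ioi 0)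
    (IsNoetherian.noetherian (Submodule.span R {r : R | ∃ t ∈ Set.Ioi 0, r ∈ 𝒜 t}))
  obtain ⟨δ, hδ, hδS⟩ : ∃ δ > 0, ∀ g ∈ S, δ ≤ d g := by
    rcases S.eq_empty_or_nonempty with rfl | hne
    · exact ⟨1, one_pos, by simp⟩
    · obtain ⟨g, hg, hmin⟩ := S.exists_min_image d hne
      exact ⟨d g, (hd g hg).1, hmin⟩
  have key (j : ℕ) : ∀ x < j * δ, FiniteDimensional k (gradedLE 𝒜 x) := by
    induction j with
    | zero =>
      intro x hx
      rw [gradedLE_eq_bot hneg (by simpa using hx)]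
      infer_instance
    | succ j ih =>
      intro x hx
      have (g : S) : FiniteDimensional k (gradedLE 𝒜 (x - d g)) := by
        refine ih _ ?_
        have := hδS g g.2
        push_cast at hx
        linarith
      exact Submodule.finiteDimensional_of_le
        (gradedLE_le_span_one_sup 𝒜 hneg hzero fun t ht htx r hr =>
          mem_iSup_map_toSpanSingleton 𝒜 𝒜 (fun g hg => (hd g hg).2) htx hr
            (hS ▸ Submodule.subset_span ⟨t, ht, hr⟩))
  obtain ⟨j, hj⟩ := exists_nat_gt (x / δ)
  exact key j x ((div_lt_iff₀ hδ).1 hj)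

lemma quotHilb_top_of_forall_pos_le [GradedAlgebra 𝒜] [∀ x, FiniteDimensional k (gradedLE 𝒜 x)]
    {P : Ideal R} (hP : P ≠ ⊤) (hpos : ∀ t > 0, 𝒜 t ≤ P.restrictScalars k) :
    quotHilb 𝒜 P ⊤ = (Set.Ici 0).indicator 1 := by
  have h1 : (1 : R) ∉ P := (Ideal.ne_top_iff_one P).1 hP
  have h10 : (1 : R) ≠ 0 := fun h => h1 (h ▸ zero_mem P)
  funext x
  rcases lt_or_ge x 0 with hx | hx
  · rw [quotHilb, hilb_eq_zero hneg hx, hilb_eq_zero hneg hx, sub_zero,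
      Set.indicator_of_notMem (by simpa using hx)]
  · have hsup : gradedLE 𝒜 x = Submodule.span k {1} ⊔ truncLE 𝒜 P x := by
      refine le_antisymm (gradedLE_le_span_one_sup 𝒜 hneg hzero fun t ht htx =>
        le_inf (hpos t ht) (le_gradedLE 𝒜 htx)) (sup_le ?_ inf_le_right)
      rw [Submodule.span_singleton_le_iff_mem]
      exact le_gradedLE 𝒜 hx SetLike.GradedOne.one_mem
    have hdisj : Disjoint (Submodule.span k {1}) (truncLE 𝒜 P x) :=
      ((Submodule.disjoint_span_singleton' h10).2
        fun h : 1 ∈ truncLE 𝒜 P x => h1 h.1).symm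
    have h := Submodule.finrank_sup_add_finrank_inf_eq (Submodule.span k {(1 : R)}) (truncLE 𝒜 P x)
    rw [← hsup, hdisj.eq_bot, finrank_bot, add_zero, finrank_span_singleton h10] at h
    rw [Set.indicator_of_mem (Set.mem_Ici.2 hx), Pi.one_apply, quotHilb, hilb, hilb, truncLE_top, h]
    push_cast
    ring

end Connected

end HilbertFunction

section Devissage

variable {k R M : Type*} [Field k] [CommRing R] [IsNoetherianRing R] [Algebra k R]
  [AddCommGroup M] [Module k M] [Module R M] [IsScalarTower k R M] [IsNoetherian R M]
  (𝒜 : ℝ → Submodule k R) [GradedAlgebra 𝒜] [∀ x, FiniteDimensional k (gradedLE 𝒜 x)]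
  (ℳ : ℝ → Submodule k M) [DirectSum.Decomposition ℳ] [SetLike.GradedSMul 𝒜 ℳ]
  [∀ x, FiniteDimensional k (gradedLE ℳ x)]

lemma quotHilb_induction {p : (ℝ → ℝ) → Prop} (zero : p 0)
    (add : ∀ f g, p f → p g → p fun x => f x + g x) (shift : ∀ f c, p f → p fun x => f (x - c))
    (I : Ideal R)
    (prime : ∀ P : Ideal R, P.IsPrime → P.IsHomogeneous 𝒜 → I ≤ P → p (quotHilb 𝒜 P ⊤))
    {N N' : Submodule R M} (hN : N.IsHomogeneous ℳ) (hN' : N'.IsHomogeneous ℳ) (hle : N ≤ N')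
    (hI : ∀ r ∈ I, ∀ m ∈ N', r • m ∈ N) : p (quotHilb ℳ N N') := by
  revert hI
  refine homogeneous_induction 𝒜 hN'
    (C := fun N => (∀ r ∈ I, ∀ m ∈ N', r • m ∈ N) → p (quotHilb ℳ N N')) ?_ ?_ N hle hN
  · exact fun _ => (quotHilb_self ℳ N').symm ▸ zero
  · intro N _ hN e m hm hmN' hp ih hI
    rw [← quotHilb_add_quotHilb ℳ N (N ⊔ Submodule.span R {m}),
      quotHilb_sup_span_singleton 𝒜 ℳ hN hm]
    refine add _ _ (shift _ e (prime _ hp (isHomogeneous_colon_singleton 𝒜 hN hm) fun r hr => ?_))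
      (ih fun r hr n hn => Submodule.mem_sup_left (hI r hr n hn))
    exact Submodule.mem_colon_singleton.2 (hI r hr m hmN')

end Devissage

section PrimeExpansions

variable {k R : Type*} [Field k] [CommRing R] [Algebra k R] (𝒜 : ℝ → Submodule k R)
  [GradedAlgebra 𝒜]

variable {𝒜} in
lemma le_restrictScalars_of_isMax (hneg : ∀ t < 0, 𝒜 t = ⊥) {P : PrimeSpectrum R}
    (hmax : IsMax P) (hP : P.asIdeal.IsHomogeneous 𝒜) {t : ℝ} (ht : 0 < t) :
    𝒜 t ≤ P.asIdeal.restrictScalars k := by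
  intro c hc
  by_contra hcP
  have hPmax : P.asIdeal.IsMaximal := PrimeSpectrum.isMax_iff.1 hmax
  obtain ⟨r, p, hp, hrp⟩ := hPmax.exists_inv hcP
  have hdeg : (DirectSum.decompose 𝒜 r (0 - t) : R) = 0 :=
    (Submodule.mem_bot k).1 (hneg (0 - t) (by linarith) ▸ SetLike.coe_mem _)
  have hone : (DirectSum.decompose 𝒜 (r • c + p) 0 : R) = 1 := by
    rw [smul_eq_mul, hrp]
    exact DirectSum.decompose_of_mem_same 𝒜 SetLike.GradedOne.one_mem
  rw [DirectSum.decompose_add, DirectSum.add_apply, AddMemClass.coe_add,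
    decompose_smul_of_mem 𝒜 𝒜 0 hc, hdeg, zero_smul, zero_add] at hone
  exact hPmax.ne_top ((Ideal.eq_top_iff_one _).2 (hone ▸ hP 0 hp))

lemma colon_singleton_eq_self {P : Ideal R} (hP : P.IsPrime) {c : R} (hc : c ∉ P) :
    P.colon {c} = P := by
  ext r
  rw [Submodule.mem_colon_singleton, smul_eq_mul]
  exact ⟨fun h => (hP.mem_or_mem h).resolve_right hc, fun h => P.mul_mem_right c h⟩

lemma coheight_le_of_lt {α : Type*} [Preorder α] {a b : α} (hab : a < b) {d : ℕ}
    (ha : Order.coheight a ≤ (d + 1 : ℕ)) : Order.coheight b ≤ d := by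
  have h := (Order.coheight_add_one_le hab).trans ha
  push_cast at h
  exact (ENat.add_le_add_iff_right ENat.one_ne_top).1 h

variable [IsNoetherianRing R] [∀ x, FiniteDimensional k (gradedLE 𝒜 x)]
  (hneg : ∀ t < 0, 𝒜 t = ⊥) (hzero : ∀ r ∈ 𝒜 0, ∃ c : k, algebraMap k R c = r)

include hneg in
lemma expandable_quotHilb_succ {d : ℕ} {P : Ideal R} (hP : P.IsPrime) (hPh : P.IsHomogeneous 𝒜)
    {γ : ℝ} (hγ : 0 < γ) {c : R} (hc : c ∈ 𝒜 γ) (hcP : c ∉ P)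
    (h : ∀ Q : Ideal R, Q.IsPrime → Q.IsHomogeneous 𝒜 → P < Q → Expandable d (quotHilb 𝒜 Q ⊤)) :
    Expandable (d + 1) (quotHilb 𝒜 P ⊤) := by
  have hlt : P < P ⊔ Submodule.span R {c} :=
    left_lt_sup.2 fun hle => hcP (hle (Submodule.mem_span_singleton_self c))
  have hquot : Expandable d (quotHilb 𝒜 (P ⊔ Submodule.span R {c}) ⊤) := by
    refine quotHilb_induction 𝒜 𝒜 (Expandable.zero d) (fun _ _ => Expandable.add)
      (fun _ => Expandable.shift) (P ⊔ Submodule.span R {c})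
      (fun Q hQ hQh hle => h Q hQ hQh (hlt.trans_le hle))
      (isHomogeneous_sup_span_singleton 𝒜 𝒜 hPh hc) (isHomogeneous_top 𝒜) le_top
      fun r hr m _ => Ideal.mul_mem_right m _ hr
  refine Expandable.of_sub_shift hγ (isTame_quotHilb 𝒜 P ⊤ ⟨0, hneg⟩) ?_
  convert! hquot using 1
  have hstep := quotHilb_sup_span_singleton 𝒜 𝒜 hPh hc
  rw [colon_singleton_eq_self hP hcP] at hstep
  funext x
  rw [← congrFun hstep x, ← congrFun (quotHilb_add_quotHilb 𝒜 P (P ⊔ Submodule.span R {c}) ⊤) x,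
    add_sub_cancel_left]

include hneg hzero

lemma expandable_quotHilb_of_coheight_le (d : ℕ) (P : PrimeSpectrum R)
    (hP : P.asIdeal.IsHomogeneous 𝒜) (hd : Order.coheight P ≤ d) :
    Expandable d (quotHilb 𝒜 P.asIdeal ⊤) := by
  by_cases hpos : ∀ t > 0, 𝒜 t ≤ P.asIdeal.restrictScalars k
  · rw [quotHilb_top_of_forall_pos_le 𝒜 hneg hzero P.isPrime.ne_top hpos]
    exact Expandable.mono ⟨_, _, HasExpansion.indicator_Ici⟩ d.zero_le
  induction d generalizing P with
  | zero =>
    have hmax : IsMax P := by simpa using hd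
    exact absurd (fun t ht => le_restrictScalars_of_isMax hneg hmax hP ht) hpos
  | succ d ih =>
    push Not at hpos
    obtain ⟨γ, hγ, hγP⟩ := hpos
    obtain ⟨c, hc, hcP⟩ := SetLike.not_le_iff_exists.1 hγP
    refine expandable_quotHilb_succ 𝒜 hneg P.isPrime hP hγ hc hcP fun Q hQ hQh hPQ => ?_
    by_cases hpos : ∀ t > 0, 𝒜 t ≤ Q.restrictScalars k
    · rw [quotHilb_top_of_forall_pos_le 𝒜 hneg hzero hQ.ne_top hpos]
      exact Expandable.mono ⟨_, _, HasExpansion.indicator_Ici⟩ d.zero_le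
    · exact ih ⟨Q, hQ⟩ hQh
        (coheight_le_of_lt (show P < (⟨Q, hQ⟩ : PrimeSpectrum R) from hPQ) hd) hpos

/-- The order-`d` expansions of the Hilbert functions of the quotients `R / P` by homogeneous
primes that a `(d + 1)`-dimensional graded domain `R` provides: they exist for `P ≠ ⊥`, and their
leading coefficient vanishes when `R / P` has dimension less than `d`. -/
structure HasPrimeExpansions (d : ℕ) : Prop where
  expandable : ∀ P : Ideal R, P.IsPrime → P.IsHomogeneous 𝒜 → P ≠ ⊥ →
    Expandable d (quotHilb 𝒜 P ⊤)
  hasExpansion_zero : ∀ P Q : Ideal R, P.IsPrime → Q.IsPrime → Q.IsHomogeneous 𝒜 → P ≠ ⊥ →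
    P < Q → ∃ β, HasExpansion d (quotHilb 𝒜 Q ⊤) 0 β

lemma hasPrimeExpansions [IsDomain R] {d : ℕ} (hdim : ringKrullDim R = (d + 1 : ℕ)) :
    HasPrimeExpansions 𝒜 d := by
  have hbot : Order.coheight (⟨⊥, Ideal.isPrime_bot⟩ : PrimeSpectrum R) ≤ (d + 1 : ℕ) :=
    WithBot.coe_le_coe.1 ((Order.coheight_le_krullDim _).trans_eq hdim)
  have hcoheight : ∀ (P : Ideal R) (hP : P.IsPrime), P ≠ ⊥ →
      Order.coheight (⟨P, hP⟩ : PrimeSpectrum R) ≤ d := fun P hP hne =>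
    coheight_le_of_lt (show (⟨⊥, Ideal.isPrime_bot⟩ : PrimeSpectrum R) < ⟨P, hP⟩ from
      (bot_lt_iff_ne_bot.2 hne : (⊥ : Ideal R) < P)) hbot
  refine ⟨fun P hP hPh hne => expandable_quotHilb_of_coheight_le 𝒜 hneg hzero d ⟨P, hP⟩ hPh
    (hcoheight P hP hne), fun P Q hP hQ hQh hne hPQ => ?_⟩
  have hlt : (⟨P, hP⟩ : PrimeSpectrum R) < ⟨Q, hQ⟩ := hPQ
  have hle := hcoheight P hP hne
  cases d with
  | zero => simpa using (Order.coheight_add_one_le hlt).trans hle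
  | succ d =>
    exact (expandable_quotHilb_of_coheight_le 𝒜 hneg hzero d ⟨Q, hQ⟩ hQh
      (coheight_le_of_lt hlt hle)).hasExpansion_zero_of_lt d.lt_succ_self

lemma expandable_hilb_top [IsDomain R] {n : ℕ} (hdim : ringKrullDim R = n) :
    Expandable n (hilb 𝒜 (⊤ : Ideal R)) := by
  have h := expandable_quotHilb_of_coheight_le 𝒜 hneg hzero n ⟨⊥, Ideal.isPrime_bot⟩
    (Ideal.IsHomogeneous.bot 𝒜)
    (WithBot.coe_le_coe.1 ((Order.coheight_le_krullDim _).trans_eq hdim))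
  convert! h using 1
  exact funext fun x => by rw [quotHilb, hilb_bot, Pi.zero_apply, sub_zero]

end PrimeExpansions

section TorsionQuotients

variable {k R M : Type*} [Field k] [CommRing R] [IsNoetherianRing R] [Algebra k R]
  [AddCommGroup M] [Module k M] [Module R M] [IsScalarTower k R M] [IsNoetherian R M]
  {𝒜 : ℝ → Submodule k R} [GradedAlgebra 𝒜] [∀ x, FiniteDimensional k (gradedLE 𝒜 x)]
  (ℳ : ℝ → Submodule k M) [DirectSum.Decomposition ℳ] [SetLike.GradedSMul 𝒜 ℳ]
  [∀ x, FiniteDimensional k (gradedLE ℳ x)]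

lemma HasPrimeExpansions.expandable_of_smul_mem {d : ℕ} (h : HasPrimeExpansions 𝒜 d) {s : R}
    (hs : s ≠ 0) {N N' : Submodule R M} (hN : N.IsHomogeneous ℳ) (hN' : N'.IsHomogeneous ℳ)
    (hle : N ≤ N') (hsN : ∀ m ∈ N', s • m ∈ N) : Expandable d (quotHilb ℳ N N') := by
  refine quotHilb_induction 𝒜 ℳ (Expandable.zero d) (fun _ _ => Expandable.add)
    (fun _ => Expandable.shift) (Ideal.span {s}) (fun P hP hPh hsP => h.expandable P hP hPh ?_)
    hN hN' hle fun r hr m hm => ?_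
  · rintro rfl
    exact hs ((Submodule.mem_bot R).1 (hsP (Ideal.mem_span_singleton_self s)))
  · obtain ⟨c, rfl⟩ := Ideal.mem_span_singleton'.1 hr
    rw [mul_smul]
    exact N.smul_mem c (hsN m hm)

end TorsionQuotients

section NormalDomain

variable {R : Type*} [CommRing R] [IsDomain R]

lemma exists_mul_eq_mul_notMem [IsIntegrallyClosed R] [IsNoetherianRing R] {q a : R} {P : Ideal R}
    (hq : q ≠ 0) (hP : P ≠ ⊥) (ha : a ∈ (Ideal.span {q}).colon P) (haq : a ∉ Ideal.span {q}) :
    ∃ p ∈ P, ∃ c, c ∉ P ∧ a * p = q * c := by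
  -- Otherwise `a / q` maps `P` into itself, so it is integral over `R` and `q` divides `a`.
  by_contra! hcon
  let K := FractionRing R
  have hq' : algebraMap R K q ≠ 0 := by simpa using hq
  let N : Submodule R K := Submodule.map (Algebra.linearMap R K) P
  have hN : N ≠ ⊥ := fun h => hP (Submodule.map_injective_of_injective
    (IsFractionRing.injective R K) (h.trans (Submodule.map_bot _).symm))
  have hint : IsIntegral R (algebraMap R K a / algebraMap R K q) := by
    refine isIntegral_of_smul_mem_submodule N hN ((IsNoetherian.noetherian P).map _) _ ?_
    rintro _ ⟨p, hp, rfl⟩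
    obtain ⟨c, hc⟩ := Ideal.mem_span_singleton.1 (Submodule.mem_colon.1 ha p hp)
    refine ⟨c, by_contra fun hcP => hcon p hp c hcP hc, ?_⟩
    rw [Algebra.linearMap_apply, Algebra.linearMap_apply, smul_eq_mul, div_mul_eq_mul_div,
      ← map_mul, ← smul_eq_mul a p, hc, map_mul, mul_div_cancel_left₀ _ hq']
  obtain ⟨y, hy⟩ := IsIntegrallyClosed.isIntegral_iff.1 hint
  refine haq (Ideal.mem_span_singleton'.2 ⟨y, IsFractionRing.injective R K ?_⟩)
  rw [map_mul, hy, div_mul_cancel₀ _ hq']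

lemma mul_mem_span_singleton_of_mem_colon {q a p c x : R} {P : Ideal R} (hq : q ≠ 0) (hp : p ∈ P)
    (hpc : a * p = q * c) (hx : x ∈ (Ideal.span {q}).colon P) : c * x ∈ Ideal.span {a} := by
  obtain ⟨y, hy⟩ := Ideal.mem_span_singleton.1 (Submodule.mem_colon.1 hx p hp)
  refine Ideal.mem_span_singleton.2 ⟨y, mul_left_cancel₀ hq ?_⟩
  rw [smul_eq_mul] at hy
  linear_combination a * hy - x * hpc

end NormalDomain

section LeadingCoefficients

variable {k R M : Type*} [Field k] [CommRing R] [IsNoetherianRing R] [Algebra k R]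
  [AddCommGroup M] [Module k M] [Module R M] [IsScalarTower k R M] [IsNoetherian R M]
  {𝒜 : ℝ → Submodule k R} [GradedAlgebra 𝒜] [∀ x, FiniteDimensional k (gradedLE 𝒜 x)]
  (ℳ : ℝ → Submodule k M) [DirectSum.Decomposition ℳ] [SetLike.GradedSMul 𝒜 ℳ]
  [∀ x, FiniteDimensional k (gradedLE ℳ x)] {d : ℕ}

lemma HasPrimeExpansions.leadCoeff_eq_zero (h : HasPrimeExpansions 𝒜 d) {P : Ideal R}
    (hP : P.IsPrime) (hP0 : P ≠ ⊥) {c : R} (hc : c ∉ P) {N N' : Submodule R M}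
    (hN : N.IsHomogeneous ℳ) (hN' : N'.IsHomogeneous ℳ) (hle : N ≤ N')
    (hPN : ∀ r ∈ P, ∀ m ∈ N', r • m ∈ N) (hcN : ∀ m ∈ N', c • m ∈ N) :
    leadCoeff d (quotHilb ℳ N N') = 0 := by
  have hlt : P < P ⊔ Ideal.span {c} :=
    left_lt_sup.2 fun hle => hc (hle (Ideal.mem_span_singleton_self c))
  obtain ⟨β, hβ⟩ := quotHilb_induction 𝒜 ℳ (p := fun f => ∃ β, HasExpansion d f 0 β)
    ⟨0, HasExpansion.zero d⟩ (fun _ _ ⟨_, hf⟩ ⟨_, hg⟩ => ⟨_, by simpa using hf.add hg⟩)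
    (fun _ e ⟨_, hf⟩ => ⟨_, hf.shift e⟩) (P ⊔ Ideal.span {c})
    (fun Q hQ hQh hle => h.hasExpansion_zero P Q hP hQ hQh hP0 (hlt.trans_le hle)) hN hN' hle
    fun r hr m hm => by
      obtain ⟨p, hp, y, hy, rfl⟩ := Submodule.mem_sup.1 hr
      obtain ⟨b, rfl⟩ := Ideal.mem_span_singleton'.1 hy
      rw [add_smul, mul_smul]
      exact N.add_mem (hPN p hp m hm) (N.smul_mem b (hcN m hm))
  exact hβ.leadCoeff_eq

lemma HasPrimeExpansions.leadCoeff_trans (h : HasPrimeExpansions 𝒜 d) {s : R} (hs : s ≠ 0)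
    {N₁ N₂ N₃ : Submodule R M} (h₁ : N₁.IsHomogeneous ℳ) (h₂ : N₂.IsHomogeneous ℳ)
    (h₃ : N₃.IsHomogeneous ℳ) (h₁₂ : N₁ ≤ N₂) (h₂₃ : N₂ ≤ N₃) (hsN : ∀ m ∈ N₃, s • m ∈ N₁) :
    leadCoeff d (quotHilb ℳ N₁ N₃) =
      leadCoeff d (quotHilb ℳ N₁ N₂) + leadCoeff d (quotHilb ℳ N₂ N₃) := by
  rw [← quotHilb_add_quotHilb ℳ N₁ N₂ N₃, Expandable.leadCoeff_add
    (h.expandable_of_smul_mem ℳ hs h₁ h₂ h₁₂ fun m hm => hsN m (h₂₃ hm))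
    (h.expandable_of_smul_mem ℳ hs h₂ h₃ h₂₃ fun m hm => h₁₂ (hsN m hm))]

lemma HasPrimeExpansions.leadCoeff_colon_le [IsDomain R] [IsIntegrallyClosed R]
    (h : HasPrimeExpansions 𝒜 d) {q : R} {δ : ℝ} (hq0 : q ≠ 0) (hq : q ∈ 𝒜 δ) {P : Ideal R}
    (hP : P.IsPrime) (hPh : P.IsHomogeneous 𝒜) (hP0 : P ≠ ⊥) :
    leadCoeff d (quotHilb 𝒜 (Ideal.span {q}) ((Ideal.span {q}).colon P)) ≤
      leadCoeff d (quotHilb 𝒜 P ⊤) := by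
  obtain ⟨s, hsP, hs⟩ := Submodule.exists_mem_ne_zero_of_ne_bot hP0
  have hqh : (Ideal.span {q}).IsHomogeneous 𝒜 :=
    isHomogeneous_span 𝒜 𝒜 fun _ hx => ⟨δ, Set.mem_singleton_iff.1 hx ▸ hq⟩
  have hCh := isHomogeneous_colon_coe 𝒜 hqh hPh
  have hqC : Ideal.span {q} ≤ (Ideal.span {q}).colon P := Ideal.le_colon
  have hPC : ∀ p ∈ P, ∀ x ∈ (Ideal.span {q}).colon P, p • x ∈ Ideal.span {q} := fun p hp x hx => by
    simpa only [smul_eq_mul, mul_comm] using Submodule.mem_colon.1 hx p hp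
  have hP' := h.expandable P hP hPh hP0
  by_cases hC : (Ideal.span {q}).colon P ≤ Ideal.span {q}
  · refine Expandable.leadCoeff_le (h.expandable_of_smul_mem 𝒜 hs hqh hCh hqC (hPC s hsP)) hP'
      fun x => ?_
    rw [le_antisymm hC hqC, quotHilb_self]
    exact sub_nonneg.2 (hilb_mono_left 𝒜 le_top x)
  obtain ⟨e, a, hae, haC, haq⟩ := exists_homogeneous_mem_notMem hqh hCh hC
  obtain ⟨p, hp, c, hc, hpc⟩ := exists_mul_eq_mul_notMem hq0 hP0 haC haq
  have hah := isHomogeneous_sup_span_singleton 𝒜 𝒜 hqh hae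
  have haC' : Ideal.span {q} ⊔ Submodule.span R {a} ≤ (Ideal.span {q}).colon P :=
    sup_le hqC ((Submodule.span_singleton_le_iff_mem _ _).2 haC)
  have hzero : leadCoeff d (quotHilb 𝒜 (Ideal.span {q} ⊔ Submodule.span R {a})
      ((Ideal.span {q}).colon P)) = 0 :=
    h.leadCoeff_eq_zero 𝒜 hP hP0 hc hah hCh haC'
      (fun r hr x hx => Submodule.mem_sup_left (hPC r hr x hx))
      fun x hx => Submodule.mem_sup_right (mul_mem_span_singleton_of_mem_colon hq0 hp hpc hx)
  rw [h.leadCoeff_trans 𝒜 hs hqh hah hCh le_sup_left haC' (hPC s hsP), hzero, add_zero,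
    ← hP'.leadCoeff_shift e]
  refine Expandable.leadCoeff_le (h.expandable_of_smul_mem 𝒜 hs hqh hah le_sup_left
    fun x hx => hPC s hsP x (haC' hx)) (hP'.shift e) fun x => ?_
  rw [quotHilb_sup_span_singleton 𝒜 𝒜 hqh hae]
  refine sub_le_sub_left (hilb_mono_left 𝒜 (fun r hr => ?_) _) _
  exact Submodule.mem_colon_singleton.2 (hPC r hr a haC)

end LeadingCoefficients

section CompatibleMaps

section Order

variable {R M M₂ : Type*} [CommSemiring R] [AddCommMonoid M] [Module R M] [AddCommMonoid M₂]
  [Module R M₂]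

lemma compatibleMaps_anti {N N' : Submodule R M} (h : N ≤ N') (J : Submodule R M₂) :
    N'.compatibleMaps J ≤ N.compatibleMaps J := fun _ hf => h.trans hf

lemma smul_mem_compatibleMaps {N N' : Submodule R M} {J : Submodule R M₂} {s : R}
    (hs : ∀ m ∈ N', s • m ∈ N) : ∀ f ∈ N.compatibleMaps J, s • f ∈ N'.compatibleMaps J :=
  fun f hf m hm => by
    rw [Submodule.mem_comap, LinearMap.smul_apply, ← map_smul]
    exact hf (hs m hm)

end Order

variable {k R M : Type*} [Field k] [CommRing R] [Algebra k R] [AddCommGroup M] [Module k M]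
  [Module R M] (𝒜 : ℝ → Submodule k R) (ℳ : ℝ → Submodule k M)

section Homogeneous

variable [GradedAlgebra 𝒜] [DirectSum.Decomposition (dualGrading 𝒜 ℳ)]

lemma decompose_dualGrading_apply (l : ℝ) {t : ℝ} {m : M} (hm : m ∈ ℳ t) (f : Module.Dual R M) :
    (DirectSum.decompose (dualGrading 𝒜 ℳ) f l : Module.Dual R M) m =
      DirectSum.decompose 𝒜 (f m) (l + t) := by
  induction f using DirectSum.Decomposition.inductionOn (dualGrading 𝒜 ℳ) with
  | zero => simp
  | add f g hf hg => simp only [DirectSum.decompose_add, DirectSum.add_apply, AddMemClass.coe_add,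
      LinearMap.add_apply, hf, hg]
  | @homogeneous i f =>
    have h := f.2 t m hm
    obtain rfl | hil := eq_or_ne i l
    · rw [DirectSum.decompose_of_mem_same _ f.2, DirectSum.decompose_of_mem_same 𝒜 h]
    · rw [DirectSum.decompose_of_mem_ne _ f.2 hil,
        DirectSum.decompose_of_mem_ne 𝒜 h (fun h => hil (add_right_cancel h)),
        LinearMap.zero_apply]

lemma isHomogeneous_compatibleMaps [DirectSum.Decomposition ℳ] {N : Submodule R M} {J : Ideal R}
    (hN : N.IsHomogeneous ℳ) (hJ : J.IsHomogeneous 𝒜) :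
    (N.compatibleMaps J).IsHomogeneous (dualGrading 𝒜 ℳ) := by
  classical
  intro l f hf m hm
  rw [Submodule.mem_comap, ← DirectSum.sum_support_decompose ℳ m, map_sum]
  refine J.sum_mem fun t _ => ?_
  rw [decompose_dualGrading_apply 𝒜 ℳ l (SetLike.coe_mem _)]
  exact hJ _ (hf (hN t hm))

end Homogeneous

lemma gradedLE_dualGrading_le_comap_applyₗ {e : ℝ} {m : M} (hm : m ∈ ℳ e) (x : ℝ) :
    gradedLE (dualGrading 𝒜 ℳ) x ≤
      (gradedLE 𝒜 (x + e)).comap ((LinearMap.applyₗ m).restrictScalars k) :=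
  iSup₂_le fun t ht f hf => le_gradedLE 𝒜 (by linarith) (hf e m hm)

variable (N : Submodule R M) (J : Ideal R) {e : ℝ} {m : M} (hm : m ∈ ℳ e) (x : ℝ)
include hm

lemma truncLE_compatibleMaps_inf_comap_applyₗ :
    truncLE (dualGrading 𝒜 ℳ) (N.compatibleMaps J) x ⊓
        (truncLE 𝒜 J (x + e)).comap ((LinearMap.applyₗ m).restrictScalars k) =
      truncLE (dualGrading 𝒜 ℳ) ((N ⊔ Submodule.span R {m}).compatibleMaps J) x := by
  ext f
  constructor
  · rintro ⟨⟨hf, hfx⟩, hfJ, -⟩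
    exact ⟨show _ ≤ Submodule.comap f J from
      sup_le hf ((Submodule.span_singleton_le_iff_mem m (Submodule.comap f J)).2 hfJ), hfx⟩
  · rintro ⟨hf, hfx⟩
    have hf := sup_le_iff.1 (show _ ≤ Submodule.comap f J from hf)
    exact ⟨⟨hf.1, hfx⟩, (Submodule.span_singleton_le_iff_mem m (Submodule.comap f J)).1 hf.2,
      gradedLE_dualGrading_le_comap_applyₗ 𝒜 ℳ hm x hfx⟩

lemma map_applyₗ_truncLE_compatibleMaps_sup_le :
    (truncLE (dualGrading 𝒜 ℳ) (N.compatibleMaps J) x).map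
        ((LinearMap.applyₗ m).restrictScalars k) ⊔ truncLE 𝒜 J (x + e) ≤
      truncLE 𝒜 (J.colon (N.colon {m})) (x + e) := by
  refine sup_le ?_ (inf_le_inf_right _ fun r hr => Ideal.le_colon hr)
  rintro _ ⟨f, ⟨hf, hfx⟩, rfl⟩
  refine ⟨Submodule.mem_colon.2 fun r hr => ?_, gradedLE_dualGrading_le_comap_applyₗ 𝒜 ℳ hm x hfx⟩
  have hrm : f (r • m) ∈ J := hf (Submodule.mem_colon_singleton.1 hr)
  rwa [map_smul, smul_eq_mul, mul_comm] at hrm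

lemma quotHilb_compatibleMaps_sup_le [IsScalarTower k R M]
    [∀ x, FiniteDimensional k (gradedLE 𝒜 x)]
    [∀ x, FiniteDimensional k (gradedLE (dualGrading 𝒜 ℳ) x)] :
    quotHilb (dualGrading 𝒜 ℳ) ((N ⊔ Submodule.span R {m}).compatibleMaps J) (N.compatibleMaps J) x
      ≤ quotHilb 𝒜 J (J.colon (N.colon {m})) (x + e) := by
  have hrank := finrank_map_sup_add_finrank_inf_comap (V := Module.Dual R M)
    ((LinearMap.applyₗ m).restrictScalars k)
    (truncLE (dualGrading 𝒜 ℳ) (N.compatibleMaps J) x) (truncLE 𝒜 J (x + e))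
  rw [truncLE_compatibleMaps_inf_comap_applyₗ 𝒜 ℳ N J hm x] at hrank
  have hle := Submodule.finrank_mono (map_applyₗ_truncLE_compatibleMaps_sup_le 𝒜 ℳ N J hm x)
  simp only [quotHilb, hilb]
  rw [sub_le_sub_iff, add_comm (Module.finrank k (truncLE 𝒜 _ _) : ℝ)]
  norm_cast
  omega

end CompatibleMaps

section DualLeadingCoefficients

variable {k R M : Type*} [Field k] [CommRing R] [IsNoetherianRing R] [Algebra k R]
  [AddCommGroup M] [Module k M] [Module R M] [IsScalarTower k R M] [IsNoetherian R M]
  {𝒜 : ℝ → Submodule k R} [GradedAlgebra 𝒜] [∀ x, FiniteDimensional k (gradedLE 𝒜 x)]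
  (ℳ : ℝ → Submodule k M) [DirectSum.Decomposition ℳ] [SetLike.GradedSMul 𝒜 ℳ]
  [∀ x, FiniteDimensional k (gradedLE ℳ x)] [DirectSum.Decomposition (dualGrading 𝒜 ℳ)]
  [∀ x, FiniteDimensional k (gradedLE (dualGrading 𝒜 ℳ) x)] {d : ℕ}

lemma HasPrimeExpansions.leadCoeff_compatibleMaps_sup_le [IsDomain R] [IsIntegrallyClosed R]
    (h : HasPrimeExpansions 𝒜 d) {q : R} {δ : ℝ} (hq0 : q ≠ 0) (hq : q ∈ 𝒜 δ) {s : R} (hs : s ≠ 0)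
    {N : Submodule R M} (hN : N.IsHomogeneous ℳ) {e : ℝ} {m : M} (hm : m ∈ ℳ e)
    (hsm : s • m ∈ N) (hp : (N.colon {m}).IsPrime) :
    leadCoeff d (quotHilb (dualGrading 𝒜 ℳ)
        ((N ⊔ Submodule.span R {m}).compatibleMaps (Ideal.span {q}))
        (N.compatibleMaps (Ideal.span {q}))) ≤
      leadCoeff d (quotHilb ℳ N (N ⊔ Submodule.span R {m})) := by
  have hsP : s ∈ N.colon {m} := Submodule.mem_colon_singleton.2 hsm
  have hP0 : N.colon {m} ≠ ⊥ := fun h0 => hs ((Submodule.mem_bot R).1 (h0 ▸ hsP))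
  have hPh : (N.colon {m}).IsHomogeneous 𝒜 := isHomogeneous_colon_singleton 𝒜 hN hm
  have hqh : (Ideal.span {q}).IsHomogeneous 𝒜 :=
    isHomogeneous_span 𝒜 𝒜 fun _ hx => ⟨δ, Set.mem_singleton_iff.1 hx ▸ hq⟩
  have hmh := isHomogeneous_sup_span_singleton 𝒜 ℳ hN hm
  have hcolon : Expandable d (quotHilb 𝒜 (Ideal.span {q}) ((Ideal.span {q}).colon (N.colon {m}))) :=
    h.expandable_of_smul_mem 𝒜 hs hqh (isHomogeneous_colon_coe 𝒜 hqh hPh) Ideal.le_colon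
      fun x hx => by simpa only [smul_eq_mul, mul_comm] using Submodule.mem_colon.1 hx s hsP
  have hdual := h.expandable_of_smul_mem (dualGrading 𝒜 ℳ) hs
    (isHomogeneous_compatibleMaps 𝒜 ℳ hmh hqh) (isHomogeneous_compatibleMaps 𝒜 ℳ hN hqh)
    (compatibleMaps_anti le_sup_left _) (smul_mem_compatibleMaps fun x hx => ?_)
  · calc leadCoeff d (quotHilb (dualGrading 𝒜 ℳ)
          ((N ⊔ Submodule.span R {m}).compatibleMaps (Ideal.span {q}))
          (N.compatibleMaps (Ideal.span {q})))
        ≤ leadCoeff d (fun x => quotHilb 𝒜 (Ideal.span {q})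
            ((Ideal.span {q}).colon (N.colon {m})) (x - -e)) :=
          Expandable.leadCoeff_le hdual (hcolon.shift (-e)) fun x => by
            rw [sub_neg_eq_add]
            exact quotHilb_compatibleMaps_sup_le 𝒜 ℳ N (Ideal.span {q}) hm x
      _ ≤ leadCoeff d (quotHilb 𝒜 (N.colon {m}) ⊤) := by
          rw [hcolon.leadCoeff_shift]
          exact h.leadCoeff_colon_le hq0 hq hp hPh hP0
      _ = leadCoeff d (quotHilb ℳ N (N ⊔ Submodule.span R {m})) := by
          rw [quotHilb_sup_span_singleton 𝒜 ℳ hN hm,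
            (h.expandable _ hp hPh hP0).leadCoeff_shift]
  · obtain ⟨n, hn, y, hy, rfl⟩ := Submodule.mem_sup.1 hx
    obtain ⟨r, rfl⟩ := Submodule.mem_span_singleton.1 hy
    rw [smul_add, smul_comm]
    exact N.add_mem (N.smul_mem s hn) (N.smul_mem r hsm)

lemma HasPrimeExpansions.leadCoeff_compatibleMaps_le [IsDomain R] [IsIntegrallyClosed R]
    (h : HasPrimeExpansions 𝒜 d) {q : R} {δ : ℝ} (hq0 : q ≠ 0) (hq : q ∈ 𝒜 δ) {s : R} (hs : s ≠ 0)
    {N N' : Submodule R M} (hN : N.IsHomogeneous ℳ) (hN' : N'.IsHomogeneous ℳ) (hle : N ≤ N')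
    (hsN : ∀ m ∈ N', s • m ∈ N) :
    leadCoeff d (quotHilb (dualGrading 𝒜 ℳ) (N'.compatibleMaps (Ideal.span {q}))
        (N.compatibleMaps (Ideal.span {q}))) ≤ leadCoeff d (quotHilb ℳ N N') := by
  have hqh : (Ideal.span {q}).IsHomogeneous 𝒜 :=
    isHomogeneous_span 𝒜 𝒜 fun _ hx => ⟨δ, Set.mem_singleton_iff.1 hx ▸ hq⟩
  revert hsN
  refine homogeneous_induction 𝒜 hN' (C := fun N => (∀ m ∈ N', s • m ∈ N) →
    leadCoeff d (quotHilb (dualGrading 𝒜 ℳ) (N'.compatibleMaps (Ideal.span {q}))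
      (N.compatibleMaps (Ideal.span {q}))) ≤ leadCoeff d (quotHilb ℳ N N')) ?_ ?_ N hle hN
  · intro _
    rw [quotHilb_self, quotHilb_self]
  · intro N hle hN e m hm hmN' hp ih hsN
    have hmh := isHomogeneous_sup_span_singleton 𝒜 ℳ hN hm
    have hle' : N ⊔ Submodule.span R {m} ≤ N' :=
      sup_le hle ((Submodule.span_singleton_le_iff_mem m N').2 hmN')
    rw [h.leadCoeff_trans ℳ hs hN hmh hN' le_sup_left hle' hsN,
      h.leadCoeff_trans (dualGrading 𝒜 ℳ) hs (isHomogeneous_compatibleMaps 𝒜 ℳ hN' hqh)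
        (isHomogeneous_compatibleMaps 𝒜 ℳ hmh hqh) (isHomogeneous_compatibleMaps 𝒜 ℳ hN hqh)
        (compatibleMaps_anti hle' _) (compatibleMaps_anti le_sup_left _)
        (smul_mem_compatibleMaps hsN), add_comm]
    exact add_le_add
      (h.leadCoeff_compatibleMaps_sup_le ℳ hq0 hq hs hN hm (hsN m hmN') hp)
      (ih fun n hn => Submodule.mem_sup_left (hsN n hn))

end DualLeadingCoefficients

section GenericFreeness

variable {R M : Type*} [CommRing R] [IsDomain R] [AddCommGroup M] [Module R M]
  [Module.Finite R M]

lemma finrank_eq_card_of_smul_mem_span {ι : Type*} [Fintype ι] {m : ι → M}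
    (hm : LinearIndependent R m) {s : R} (hs : s ≠ 0)
    (hsm : ∀ x, s • x ∈ Submodule.span R (Set.range m)) : Module.finrank R M = Fintype.card ι := by
  have htors : Module.IsTorsion R (M ⧸ Submodule.span R (Set.range m)) := fun {y} => by
    obtain ⟨x, rfl⟩ := Submodule.mkQ_surjective _ y
    exact ⟨⟨s, mem_nonZeroDivisors_of_ne_zero hs⟩, (Submodule.Quotient.mk_eq_zero _).2 (hsm x)⟩
  rw [← Submodule.finrank_quotient_add_finrank (Submodule.span R (Set.range m)),
    Module.finrank_eq_zero_iff_isTorsion.2 htors, zero_add, finrank_span_eq_card hm]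

variable {ι σ τ : Type*} [DecidableEq ι] [SetLike τ M] [AddSubmonoidClass τ M] (ℳ : ι → τ)
  [DirectSum.Decomposition ℳ]

lemma exists_homogeneous_linearIndependent [Nonempty ι] :
    ∃ (S : Finset M) (d : M → ι), (∀ g ∈ S, g ∈ ℳ (d g)) ∧
      LinearIndependent R ((↑) : S → M) ∧
      Module.IsTorsion R (M ⧸ Submodule.span R (S : Set M)) := by
  obtain ⟨S, d, hd, hS⟩ := exists_homogeneous_generators (R := R) ℳ
  obtain ⟨t, ht, hmax⟩ := exists_maximal_linearIndepOn R ((↑) : S → M)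
  have hfin : ((↑) '' t : Set M).Finite := t.toFinite.image _
  refine ⟨hfin.toFinset, d, fun g hg => ?_, ?_, ?_⟩
  · obtain ⟨g, -, rfl⟩ := hfin.mem_toFinset.1 hg
    exact hd g g.2
  · have := ht.id_image
    rwa [← hfin.coe_toFinset] at this
  rw [hfin.coe_toFinset]
  set F := Submodule.span R ((↑) '' t : Set M)
  have htop : ⊤ ≤ (Submodule.torsion R (M ⧸ F)).comap F.mkQ := by
    rw [← hS, Submodule.span_le]
    intro g hg
    obtain ⟨a, ha, hag⟩ : ∃ a : R, a ≠ 0 ∧ a • g ∈ F := by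
      by_cases hgt : (⟨g, hg⟩ : S) ∈ t
      · exact ⟨1, one_ne_zero, by rw [one_smul]; exact Submodule.subset_span ⟨_, hgt, rfl⟩⟩
      · exact hmax _ hgt
    exact ⟨⟨a, mem_nonZeroDivisors_of_ne_zero ha⟩, (Submodule.Quotient.mk_eq_zero F).2 hag⟩
  intro y
  obtain ⟨x, rfl⟩ := F.mkQ_surjective y
  exact htop (Submodule.mem_top (x := x))

lemma exists_homogeneous_smul_mem [AddCommGroup ι] [SetLike σ R] [AddSubmonoidClass σ R]
    (𝒜 : ι → σ) [GradedRing 𝒜] [SetLike.GradedSMul 𝒜 ℳ] {N : Submodule R M}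
    (hN : N.IsHomogeneous ℳ) (htors : Module.IsTorsion R (M ⧸ N)) :
    ∃ δ, ∃ s ∈ 𝒜 δ, s ≠ 0 ∧ ∀ x, s • x ∈ N := by
  obtain ⟨a, ha, ha0⟩ := Submodule.annihilator_top_inter_nonZeroDivisors htors
  rw [Submodule.annihilator_top, Submodule.annihilator_quotient] at ha
  have hcolon := isHomogeneous_colon_coe 𝒜 hN (isHomogeneous_top ℳ)
  have hbot := isHomogeneous_span 𝒜 𝒜 (s := ∅) (by simp)
  obtain ⟨δ, s, hsδ, hs, hs0⟩ := exists_homogeneous_mem_notMem hbot hcolon fun hle =>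
    nonZeroDivisors.ne_zero ha0 (by simpa using hle ha)
  exact ⟨δ, s, hsδ, by simpa using hs0, fun x => Submodule.mem_colon.1 hs x trivial⟩

end GenericFreeness

open scoped Pointwise

section HomogeneousSMul

lemma pointwise_smul_top_le {R M : Type*} [CommSemiring R] [AddCommMonoid M] [Module R M] {s : R}
    {N : Submodule R M} (hsN : ∀ x, s • x ∈ N) : s • (⊤ : Submodule R M) ≤ N := fun y hy => by
  obtain ⟨x, -, rfl⟩ := (Submodule.mem_smul_pointwise_iff_exists _ _ _).1 hy
  exact hsN x

section Decompose

variable {ι σ τ R M : Type*} [CommRing R] [AddCommGroup M] [Module R M] [DecidableEq ι]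
  [AddCommGroup ι] [SetLike σ R] [AddSubmonoidClass σ R] (𝒜 : ι → σ) [GradedRing 𝒜] [SetLike τ M]
  [AddSubmonoidClass τ M] (ℳ : ι → τ) [DirectSum.Decomposition ℳ] [SetLike.GradedSMul 𝒜 ℳ]

lemma decompose_homogeneous_smul (t : ι) {e : ι} {s : R} (hs : s ∈ 𝒜 e) (m : M) :
    (DirectSum.decompose ℳ (s • m) t : M) = s • (DirectSum.decompose ℳ m (t - e) : M) := by
  induction m using DirectSum.Decomposition.inductionOn ℳ with
  | zero => simp
  | add m m' h h' => simp only [smul_add, DirectSum.decompose_add, DirectSum.add_apply,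
      AddMemClass.coe_add, h, h']
  | @homogeneous i m =>
    rw [decompose_smul_of_mem 𝒜 ℳ t m.2]
    obtain rfl | hit := eq_or_ne (e + i) t
    · rw [add_sub_cancel_right, add_sub_cancel_left, DirectSum.decompose_of_mem_same 𝒜 hs,
        DirectSum.decompose_of_mem_same ℳ m.2]
    · rw [DirectSum.decompose_of_mem_ne 𝒜 hs fun h => hit (eq_sub_iff_add_eq.1 h), zero_smul,
        DirectSum.decompose_of_mem_ne ℳ m.2 fun h => hit (eq_sub_iff_add_eq'.1 h), smul_zero]

include 𝒜 in
lemma isHomogeneous_pointwise_smul {N : Submodule R M} (hN : N.IsHomogeneous ℳ) {e : ι} {s : R}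
    (hs : s ∈ 𝒜 e) : (s • N).IsHomogeneous ℳ := by
  intro t y hy
  obtain ⟨m, hm, rfl⟩ := (Submodule.mem_smul_pointwise_iff_exists _ _ _).1 hy
  rw [decompose_homogeneous_smul 𝒜 ℳ t hs]
  exact Submodule.smul_mem_pointwise_smul _ _ _ (hN _ hm)

end Decompose

variable {k R M : Type*} [Field k] [CommRing R] [Algebra k R] [AddCommGroup M] [Module k M]
  [Module R M] {𝒜 : ℝ → Submodule k R} (ℳ : ℝ → Submodule k M) [DirectSum.Decomposition ℳ]
  [SetLike.GradedSMul 𝒜 ℳ] {s : R} {δ : ℝ} (hs : s ∈ 𝒜 δ)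

include hs

lemma truncate_homogeneous_smul (x : ℝ) (m : M) :
    truncate ℳ x (s • m) = s • truncate ℳ (x - δ) m := by
  induction m using DirectSum.Decomposition.inductionOn ℳ with
  | zero => simp
  | add m m' h h' => simp only [smul_add, map_add, h, h']
  | @homogeneous t m =>
    have h : s • (m : M) ∈ ℳ (δ + t) := SetLike.GradedSMul.smul_mem hs m.2
    rw [truncate_of_mem ℳ x h, truncate_of_mem ℳ _ m.2]
    simp only [le_sub_iff_add_le, add_comm δ t]
    split_ifs <;> simp

variable [IsScalarTower k R M]

lemma truncLE_pointwise_smul {N : Submodule R M} (hN : N.IsHomogeneous ℳ) (x : ℝ) :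
    truncLE ℳ (s • N) x =
      (truncLE ℳ N (x - δ)).map ((LinearMap.lsmul R M s).restrictScalars k) := by
  apply le_antisymm
  · rintro y ⟨hy, hyx⟩
    obtain ⟨m, hm, rfl⟩ := (Submodule.mem_smul_pointwise_iff_exists _ _ _).1 hy
    have hmN : truncate ℳ (x - δ) m ∈ N.restrictScalars k :=
      truncate_mem_of_components ℳ _ fun t _ => hN t hm
    refine ⟨_, ⟨hmN, truncate_mem_gradedLE ℳ _ m⟩, ?_⟩
    exact (truncate_homogeneous_smul ℳ hs x m).symm.trans (truncate_eq_self ℳ hyx)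
  · rintro _ ⟨m, ⟨hmN, hm⟩, rfl⟩
    refine ⟨Submodule.smul_mem_pointwise_smul _ _ _ hmN, ?_⟩
    have h := truncate_mem_gradedLE ℳ x (s • m)
    rwa [truncate_homogeneous_smul ℳ hs, truncate_eq_self ℳ hm] at h

lemma hilb_pointwise_smul [IsDomain R] [Module.IsTorsionFree R M] (hs0 : s ≠ 0)
    {N : Submodule R M} (hN : N.IsHomogeneous ℳ) :
    hilb ℳ (s • N) = fun x => hilb ℳ N (x - δ) := by
  funext x
  rw [hilb, truncLE_pointwise_smul ℳ hs hN, hilb, Nat.cast_inj]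
  exact (Submodule.equivMapOfInjective _ (smul_right_injective M hs0) _).finrank_eq.symm

lemma leadCoeff_quotHilb_pointwise_smul [IsDomain R] [Module.IsTorsionFree R M] (hs0 : s ≠ 0)
    {N N' : Submodule R M} (hN : N.IsHomogeneous ℳ) (hN' : N'.IsHomogeneous ℳ) {d : ℕ}
    (h : Expandable d (quotHilb ℳ N N')) :
    leadCoeff d (quotHilb ℳ (s • N) (s • N')) = leadCoeff d (quotHilb ℳ N N') := by
  rw [← h.leadCoeff_shift δ]
  congr 1
  funext x
  rw [quotHilb, hilb_pointwise_smul ℳ hs hs0 hN, hilb_pointwise_smul ℳ hs hs0 hN', quotHilb]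

end HomogeneousSMul

section LinearIndependent

variable {k R M : Type*} [Field k] [CommRing R] [Algebra k R] [AddCommGroup M] [Module k M]
  [Module R M] [IsScalarTower k R M]

variable (𝒜 : ℝ → Submodule k R) [GradedAlgebra 𝒜] [∀ x, FiniteDimensional k (gradedLE 𝒜 x)]
  (ℳ : ℝ → Submodule k M) [DirectSum.Decomposition ℳ] [SetLike.GradedSMul 𝒜 ℳ]
  [∀ x, FiniteDimensional k (gradedLE ℳ x)] {ι : Type*} [Fintype ι] {m : ι → M} {e : ι → ℝ}

lemma hilb_span_of_linearIndependent (hm : ∀ i, m i ∈ ℳ (e i)) (hli : LinearIndependent R m) :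
    hilb ℳ (Submodule.span R (Set.range m)) = fun x => ∑ i, hilb 𝒜 (⊤ : Ideal R) (x - e i) := by
  classical
  suffices key : ∀ T : Finset ι, hilb ℳ (Submodule.span R (m '' T)) =
      fun x => ∑ i ∈ T, hilb 𝒜 (⊤ : Ideal R) (x - e i) by
    simpa only [Finset.coe_univ, Set.image_univ] using key Finset.univ
  intro T
  induction T using Finset.induction_on with
  | empty =>
    rw [Finset.coe_empty, Set.image_empty, Submodule.span_empty, hilb_bot]
    rfl
  | insert i T hi ih =>
    have hcolon : (Submodule.span R (m '' T)).colon {m i} = ⊥ := by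
      refine eq_bot_iff.2 fun r hr => ?_
      refine linearIndependent_iff_eq_zero_of_smul_mem_span.1 hli i r (Submodule.span_mono
        (Set.image_mono fun j hj => ?_) (Submodule.mem_colon_singleton.1 hr))
      exact ⟨trivial, fun h => hi (Set.mem_singleton_iff.1 h ▸ hj)⟩
    have hT : (Submodule.span R (m '' T)).IsHomogeneous ℳ :=
      isHomogeneous_span 𝒜 ℳ (Set.forall_mem_image.2 fun j _ => ⟨e j, hm j⟩)
    funext x
    have h := congrFun (quotHilb_sup_span_singleton 𝒜 ℳ hT (hm i)) x
    rw [hcolon, quotHilb, quotHilb, hilb_bot, ih, Pi.zero_apply, sub_zero] at h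
    rw [Finset.coe_insert, Set.image_insert_eq, Submodule.span_insert, sup_comm,
      Finset.sum_insert hi]
    linarith

lemma hasExpansion_hilb_span_of_linearIndependent {s : ℕ} {A B : ℝ}
    (hAB : HasExpansion s (hilb 𝒜 (⊤ : Ideal R)) A B) (hm : ∀ i, m i ∈ ℳ (e i))
    (hli : LinearIndependent R m) :
    HasExpansion s (hilb ℳ (Submodule.span R (Set.range m))) (Fintype.card ι * A)
      (Fintype.card ι * B - (∑ i, e i) * A) := by
  rw [hilb_span_of_linearIndependent 𝒜 ℳ hm hli]
  convert! HasExpansion.sum (t := Finset.univ) fun i _ => hAB.shift (e i) using 1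
  · simp
  · simp [Finset.sum_sub_distrib, Finset.sum_mul]

lemma leadCoeff_quotHilb_smul_span [IsDomain R] [Module.IsTorsionFree R M] {s : R} {δ : ℝ}
    (hs : s ∈ 𝒜 δ) (hs0 : s ≠ 0) (hm : ∀ i, m i ∈ ℳ (e i)) (hli : LinearIndependent R m) {d : ℕ}
    (hR : Expandable d (quotHilb 𝒜 (s • ⊤ : Ideal R) ⊤)) :
    leadCoeff d (quotHilb ℳ (s • Submodule.span R (Set.range m)) (Submodule.span R (Set.range m)))
      = Fintype.card ι * leadCoeff d (quotHilb 𝒜 (s • ⊤ : Ideal R) ⊤) := by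
  have hF : (Submodule.span R (Set.range m)).IsHomogeneous ℳ :=
    isHomogeneous_span 𝒜 ℳ (Set.forall_mem_range.2 fun i => ⟨e i, hm i⟩)
  have hquot : quotHilb ℳ (s • Submodule.span R (Set.range m)) (Submodule.span R (Set.range m)) =
      fun x => ∑ i, quotHilb 𝒜 (s • ⊤ : Ideal R) ⊤ (x - e i) := by
    funext x
    simp only [quotHilb, hilb_pointwise_smul ℳ hs hs0 hF,
      hilb_pointwise_smul 𝒜 hs hs0 (isHomogeneous_top 𝒜), hilb_span_of_linearIndependent 𝒜 ℳ hm hli,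
      Finset.sum_sub_distrib, sub_right_comm]
  obtain ⟨α, β, h⟩ := hR
  rw [hquot, (HasExpansion.sum (t := Finset.univ) fun i _ => h.shift (e i)).leadCoeff_eq,
    h.leadCoeff_eq, Finset.sum_const, Finset.card_univ, nsmul_eq_mul]

end LinearIndependent

section DividedDuals

variable {R M : Type*} [CommRing R] [IsDomain R] [AddCommGroup M] [Module R M] {s : R}
  (hs : s ≠ 0)
include hs

lemma exists_smul_eq_of_forall_dvd {g : Module.Dual R M} (hg : ∀ x, s ∣ g x) :
    ∃ g' : Module.Dual R M, s • g' = g := by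
  choose c hc using hg
  refine ⟨{ toFun := c, map_add' := fun x y => ?_, map_smul' := fun r x => ?_ },
    LinearMap.ext fun x => (hc x).symm⟩
  · apply mul_left_cancel₀ hs
    rw [mul_add, ← hc, ← hc, ← hc, map_add]
  · apply mul_left_cancel₀ hs
    rw [← hc, map_smul, hc, RingHom.id_apply, smul_eq_mul, smul_eq_mul, mul_left_comm]

lemma compatibleMaps_pointwise_smul (N : Submodule R M) (q : R) :
    (s • N).compatibleMaps (Ideal.span {s * q}) = N.compatibleMaps (Ideal.span {q}) := by
  have hsmul (f : Module.Dual R M) (m : M) :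
      f (s • m) ∈ Ideal.span {s * q} ↔ f m ∈ Ideal.span {q} := by
    rw [map_smul, smul_eq_mul, Ideal.mem_span_singleton, Ideal.mem_span_singleton,
      mul_dvd_mul_iff_left hs]
  ext f
  refine ⟨fun hf m hm => (hsmul f m).1 (hf (Submodule.smul_mem_pointwise_smul m s N hm)),
    fun hf y hy => ?_⟩
  obtain ⟨m, hm, rfl⟩ := (Submodule.mem_smul_pointwise_iff_exists _ _ _).1 hy
  exact (hsmul f m).2 (hf hm)

lemma compatibleMaps_span_mul_self {N : Submodule R M} (hN : ∀ x, s • x ∈ N) :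
    N.compatibleMaps (Ideal.span {s * s}) = s • N.compatibleMaps (Ideal.span {s}) := by
  have hsmul (f : Module.Dual R M) (m : M) :
      (s • f) m ∈ Ideal.span {s * s} ↔ f m ∈ Ideal.span {s} := by
    rw [LinearMap.smul_apply, smul_eq_mul, Ideal.mem_span_singleton, Ideal.mem_span_singleton,
      mul_dvd_mul_iff_left hs]
  apply le_antisymm
  · intro f hf
    obtain ⟨g, rfl⟩ := exists_smul_eq_of_forall_dvd hs fun x => by
      have hx : s * s ∣ f (s • x) := Ideal.mem_span_singleton.1 (hf (hN x))
      rwa [map_smul, smul_eq_mul, mul_dvd_mul_iff_left hs] at hx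
    exact Submodule.smul_mem_pointwise_smul g s _ fun m hm => (hsmul g m).1 (hf hm)
  · intro f hf
    obtain ⟨g, hg, rfl⟩ := (Submodule.mem_smul_pointwise_iff_exists _ _ _).1 hf
    exact fun m hm => (hsmul g m).2 (hg hm)

lemma compatibleMaps_top_span_singleton :
    (⊤ : Submodule R M).compatibleMaps (Ideal.span {s}) = s • ⊤ := by
  apply le_antisymm
  · intro f hf
    obtain ⟨g, rfl⟩ := exists_smul_eq_of_forall_dvd hs fun x =>
      Ideal.mem_span_singleton.1 (hf (Submodule.mem_top (x := x)))
    exact Submodule.smul_mem_pointwise_smul g s _ Submodule.mem_top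
  · intro f hf
    obtain ⟨g, -, rfl⟩ := (Submodule.mem_smul_pointwise_iff_exists _ _ _).1 hf
    exact fun x _ => Ideal.mem_span_singleton.2 ⟨g x, rfl⟩

end DividedDuals

section DualFamily

variable {R M ι : Type*} [CommRing R] [AddCommGroup M] [Module R M] {m : ι → M} {s : R}
  (hli : LinearIndependent R m) (hsm : ∀ x, s • x ∈ Submodule.span R (Set.range m))

/-- The functionals `s • mᵢ*`, where `mᵢ*` are the coordinates with respect to the linearly
independent family `m`. They are defined on all of `M` since `s • M` lies in the span of `m`. -/
def dualFamily (i : ι) : Module.Dual R M :=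
  (Module.Basis.span hli).coord i ∘ₗ (LinearMap.lsmul R M s).codRestrict _ hsm

lemma dualFamily_apply_self [DecidableEq ι] (i j : ι) :
    dualFamily hli hsm i (m j) = if i = j then s else 0 := by
  have h : (LinearMap.lsmul R M s).codRestrict _ hsm (m j) = s • Module.Basis.span hli j :=
    Subtype.ext (by rw [Submodule.coe_smul, Module.Basis.span_apply]; rfl)
  rw [dualFamily, LinearMap.comp_apply, h, map_smul, Module.Basis.coord_apply,
    Module.Basis.repr_self, Finsupp.single_apply, smul_eq_mul, mul_ite, mul_one, mul_zero]
  exact if_congr eq_comm rfl rfl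

lemma linearIndependent_dualFamily [IsDomain R] (hs : s ≠ 0) :
    LinearIndependent R (dualFamily hli hsm) := by
  classical
  refine linearIndependent_iff'.2 fun t c hc j hj => ?_
  have h := LinearMap.congr_fun hc (m j)
  simpa [dualFamily_apply_self, hs, hj] using h

section Fintype

variable [Fintype ι]

lemma sum_dualFamily_smul (x : M) : ∑ i, dualFamily hli hsm i x • m i = s • x := by
  have h := congrArg Subtype.val
    ((Module.Basis.span hli).sum_repr ((LinearMap.lsmul R M s).codRestrict _ hsm x))
  simp only [Submodule.coe_sum, Submodule.coe_smul, Module.Basis.span_apply] at h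
  exact h

lemma smul_eq_sum_dualFamily (g : Module.Dual R M) :
    s • g = ∑ i, g (m i) • dualFamily hli hsm i := by
  ext x
  rw [LinearMap.smul_apply, ← map_smul, ← sum_dualFamily_smul hli hsm x, map_sum,
    LinearMap.sum_apply]
  simp only [map_smul, LinearMap.smul_apply, smul_eq_mul, mul_comm]

end Fintype

variable [Finite ι]

lemma smul_mem_span_range_dualFamily (g : Module.Dual R M) :
    s • g ∈ Submodule.span R (Set.range (dualFamily hli hsm)) := by
  have := Fintype.ofFinite ι
  rw [smul_eq_sum_dualFamily hli hsm]
  exact Submodule.sum_mem _ fun i _ => Submodule.smul_mem _ _ (Submodule.subset_span ⟨i, rfl⟩)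

lemma compatibleMaps_span_range_span_singleton [IsDomain R] (hs : s ≠ 0) :
    (Submodule.span R (Set.range m)).compatibleMaps (Ideal.span {s}) =
      Submodule.span R (Set.range (dualFamily hli hsm)) := by
  classical
  have := Fintype.ofFinite ι
  apply le_antisymm
  · intro g hg
    have hdvd : ∀ i, s ∣ g (m i) := fun i =>
      Ideal.mem_span_singleton.1 (hg (Submodule.subset_span ⟨i, rfl⟩))
    choose c hc using hdvd
    have hgc : g = ∑ i, c i • dualFamily hli hsm i := by
      refine smul_right_injective _ hs ?_
      simp only [smul_eq_sum_dualFamily hli hsm g, hc, mul_smul, Finset.smul_sum]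
    rw [hgc]
    exact Submodule.sum_mem _ fun i _ => Submodule.smul_mem _ _ (Submodule.subset_span ⟨i, rfl⟩)
  · refine Submodule.span_le.2 (Set.forall_mem_range.2 fun i => ?_)
    refine Submodule.span_le.2 (Set.forall_mem_range.2 fun j => ?_)
    change dualFamily hli hsm i (m j) ∈ Ideal.span {s}
    rw [dualFamily_apply_self]
    split_ifs
    · exact Ideal.mem_span_singleton_self s
    · exact Ideal.zero_mem _

lemma dualFamily_mem_dualGrading {k : Type*} [Field k] [Algebra k R] [Module k M]
    (𝒜 : ℝ → Submodule k R) [GradedAlgebra 𝒜] (ℳ : ℝ → Submodule k M) [DirectSum.Decomposition ℳ]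
    [SetLike.GradedSMul 𝒜 ℳ] {e : ι → ℝ} {δ : ℝ} (hm : ∀ i, m i ∈ ℳ (e i)) (hs : s ∈ 𝒜 δ) (i : ι) :
    dualFamily hli hsm i ∈ dualGrading 𝒜 ℳ (δ - e i) := by
  have := Fintype.ofFinite ι
  intro t x hx
  have hsx : s • x ∈ ℳ (δ + t) := SetLike.GradedSMul.smul_mem hs hx
  have hdecomp : ∑ i, dualFamily hli hsm i x • m i =
      ∑ i, (DirectSum.decompose 𝒜 (dualFamily hli hsm i x) (δ + t - e i) : R) • m i := by
    have h := DirectSum.decompose_of_mem_same ℳ hsx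
    rw [← sum_dualFamily_smul hli hsm x, DirectSum.decompose_sum, DFinsupp.finsetSum_apply,
      AddSubmonoidClass.coe_finsetSum] at h
    exact h.symm.trans (Finset.sum_congr rfl fun i _ => decompose_smul_of_mem 𝒜 ℳ _ (hm i) _)
  rw [Fintype.linearIndependent_iffₛ.1 hli _ _ hdecomp i, sub_add_eq_add_sub]
  exact SetLike.coe_mem _

end DualFamily

section DualExpansion

variable {k R M : Type*} [Field k] [CommRing R] [IsNoetherianRing R] [Algebra k R]
  [AddCommGroup M] [Module k M] [Module R M] [IsScalarTower k R M] [IsNoetherian R M]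
  {𝒜 : ℝ → Submodule k R} [GradedAlgebra 𝒜] [∀ x, FiniteDimensional k (gradedLE 𝒜 x)]
  (ℳ : ℝ → Submodule k M) [DirectSum.Decomposition ℳ] [SetLike.GradedSMul 𝒜 ℳ]
  [∀ x, FiniteDimensional k (gradedLE ℳ x)] {d : ℕ} {s : R} (hs0 : s ≠ 0)
include hs0

lemma HasPrimeExpansions.hasExpansion_hilb_top_of_smul_mem (h : HasPrimeExpansions 𝒜 d)
    {N : Submodule R M} (hN : N.IsHomogeneous ℳ) (hsN : ∀ x, s • x ∈ N) {α β : ℝ}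
    (hαβ : HasExpansion (d + 1) (hilb ℳ N) α β) :
    HasExpansion (d + 1) (hilb ℳ (⊤ : Submodule R M)) α
      (β + leadCoeff d (quotHilb ℳ N ⊤) / (d + 1)) := by
  have hquot := (h.expandable_of_smul_mem ℳ hs0 hN (isHomogeneous_top ℳ) le_top
    fun x _ => hsN x).hasExpansion_succ
  convert! hαβ.add hquot using 1
  · exact funext fun x => (add_sub_cancel _ _).symm
  · rw [add_zero]

variable [IsDomain R] [Module.IsTorsionFree R M] {δ : ℝ} (hs : s ∈ 𝒜 δ)
include hs

lemma HasPrimeExpansions.leadCoeff_smul_top_add (h : HasPrimeExpansions 𝒜 d) {N : Submodule R M}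
    (hN : N.IsHomogeneous ℳ) (hsN : ∀ x, s • x ∈ N) :
    leadCoeff d (quotHilb ℳ (s • ⊤) N) + leadCoeff d (quotHilb ℳ N ⊤) =
      leadCoeff d (quotHilb ℳ (s • N) N) := by
  have htop := isHomogeneous_top (R := R) ℳ
  have hle : s • ⊤ ≤ N := pointwise_smul_top_le hsN
  rw [h.leadCoeff_trans ℳ hs0 (isHomogeneous_pointwise_smul 𝒜 ℳ hN hs)
      (isHomogeneous_pointwise_smul 𝒜 ℳ htop hs) hN (smul_mono_right s le_top) hle
      fun x hx => Submodule.smul_mem_pointwise_smul x s N hx,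
    leadCoeff_quotHilb_pointwise_smul ℳ hs hs0 hN htop
      (h.expandable_of_smul_mem ℳ hs0 hN htop le_top fun x _ => hsN x), add_comm]

lemma HasPrimeExpansions.hasExpansion_hilb_top_of_smul_top_le (h : HasPrimeExpansions 𝒜 d)
    {N : Submodule R M} (hN : N.IsHomogeneous ℳ) (hsN : ∀ x, s • x ∈ N) {α β : ℝ}
    (hαβ : HasExpansion (d + 1) (hilb ℳ N) α β) :
    HasExpansion (d + 1) (hilb ℳ (⊤ : Submodule R M)) α
      (β - leadCoeff d (quotHilb ℳ (s • ⊤) N) / (d + 1) + δ * α) := by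
  have htop := isHomogeneous_top (R := R) ℳ
  have hquot := (h.expandable_of_smul_mem ℳ hs0 (isHomogeneous_pointwise_smul 𝒜 ℳ htop hs) hN
    (pointwise_smul_top_le hsN)
    fun x _ => Submodule.smul_mem_pointwise_smul x s ⊤ trivial).hasExpansion_succ
  convert! (hαβ.sub hquot).shift (-δ) using 1
  · funext x
    rw [quotHilb, sub_sub_cancel, hilb_pointwise_smul ℳ hs hs0 htop, sub_neg_eq_add]
    exact congrArg _ (add_sub_cancel_right x δ).symm
  · rw [sub_zero]
  · ring

variable [IsIntegrallyClosed R] [DirectSum.Decomposition (dualGrading 𝒜 ℳ)]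
  [∀ x, FiniteDimensional k (gradedLE (dualGrading 𝒜 ℳ) x)] {ι : Type*} {m : ι → M} {e : ι → ℝ}
  (hm : ∀ i, m i ∈ ℳ (e i)) (hli : LinearIndependent R m)
  (hsm : ∀ x, s • x ∈ Submodule.span R (Set.range m))
include hm

lemma HasPrimeExpansions.leadCoeff_smul_top_span_dualFamily [Finite ι]
    (h : HasPrimeExpansions 𝒜 d) :
    leadCoeff d (quotHilb (dualGrading 𝒜 ℳ) (s • ⊤)
        (Submodule.span R (Set.range (dualFamily hli hsm)))) =
      leadCoeff d (quotHilb ℳ (Submodule.span R (Set.range m)) ⊤) := by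
  have := Fintype.ofFinite ι
  have : IsNoetherian R (Module.Dual R M) := isNoetherian_linearMap R R M
  have hf := dualFamily_mem_dualGrading hli hsm 𝒜 ℳ hm hs
  have hfli := linearIndependent_dualFamily hli hsm hs0
  have hF : (Submodule.span R (Set.range m)).IsHomogeneous ℳ :=
    isHomogeneous_span 𝒜 ℳ (Set.forall_mem_range.2 fun i => ⟨e i, hm i⟩)
  have hG : (Submodule.span R (Set.range (dualFamily hli hsm))).IsHomogeneous (dualGrading 𝒜 ℳ) :=
    isHomogeneous_span 𝒜 (dualGrading 𝒜 ℳ) (Set.forall_mem_range.2 fun i => ⟨_, hf i⟩)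
  have htop := isHomogeneous_top (R := R) ℳ
  have htop' := isHomogeneous_top (R := R) (dualGrading 𝒜 ℳ)
  have hsG := smul_mem_span_range_dualFamily hli hsm
  have hR : Expandable d (quotHilb 𝒜 (s • ⊤ : Ideal R) ⊤) :=
    h.expandable_of_smul_mem 𝒜 hs0 (isHomogeneous_pointwise_smul 𝒜 𝒜 (isHomogeneous_top 𝒜) hs)
      (isHomogeneous_top 𝒜) le_top fun x hx => Submodule.smul_mem_pointwise_smul x s ⊤ hx
  have htotal := h.leadCoeff_smul_top_add ℳ hs0 hs hF hsm
  have htotal' := h.leadCoeff_smul_top_add (dualGrading 𝒜 ℳ) hs0 hs hG hsG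
  rw [leadCoeff_quotHilb_smul_span 𝒜 ℳ hs hs0 hm hli hR] at htotal
  rw [leadCoeff_quotHilb_smul_span 𝒜 (dualGrading 𝒜 ℳ) hs hs0 hf hfli hR] at htotal'
  have hle := h.leadCoeff_compatibleMaps_le ℳ hs0 hs hs0 hF htop le_top fun x _ => hsm x
  have hle' := h.leadCoeff_compatibleMaps_le ℳ (mul_ne_zero hs0 hs0) (SetLike.mul_mem_graded hs hs)
    hs0 (isHomogeneous_pointwise_smul 𝒜 ℳ htop hs) hF (pointwise_smul_top_le hsm)
    fun x _ => Submodule.smul_mem_pointwise_smul x s ⊤ trivial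
  rw [compatibleMaps_top_span_singleton hs0,
    compatibleMaps_span_range_span_singleton hli hsm hs0] at hle
  rw [compatibleMaps_span_mul_self hs0 hsm, compatibleMaps_pointwise_smul hs0,
    compatibleMaps_top_span_singleton hs0, compatibleMaps_span_range_span_singleton hli hsm hs0,
    leadCoeff_quotHilb_pointwise_smul (dualGrading 𝒜 ℳ) hs hs0 hG htop'
      (h.expandable_of_smul_mem _ hs0 hG htop' le_top fun x _ => hsG x)] at hle'
  linarith

include hli hsm in
lemma HasPrimeExpansions.exists_hasExpansion_dual [Fintype ι] (h : HasPrimeExpansions 𝒜 d) {A B : ℝ}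
    (hAB : HasExpansion (d + 1) (hilb 𝒜 (⊤ : Ideal R)) A B) :
    ∃ α β, HasExpansion (d + 1) (hilb ℳ (⊤ : Submodule R M)) α β ∧
      HasExpansion (d + 1) (hilb (dualGrading 𝒜 ℳ) (⊤ : Submodule R (Module.Dual R M))) α
        (2 * Fintype.card ι * B - β) := by
  have : IsNoetherian R (Module.Dual R M) := isNoetherian_linearMap R R M
  have hf := dualFamily_mem_dualGrading hli hsm 𝒜 ℳ hm hs
  have hF : (Submodule.span R (Set.range m)).IsHomogeneous ℳ :=
    isHomogeneous_span 𝒜 ℳ (Set.forall_mem_range.2 fun i => ⟨e i, hm i⟩)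
  have hG : (Submodule.span R (Set.range (dualFamily hli hsm))).IsHomogeneous (dualGrading 𝒜 ℳ) :=
    isHomogeneous_span 𝒜 (dualGrading 𝒜 ℳ) (Set.forall_mem_range.2 fun i => ⟨_, hf i⟩)
  refine ⟨_, _, h.hasExpansion_hilb_top_of_smul_mem ℳ hs0 hF hsm
    (hasExpansion_hilb_span_of_linearIndependent 𝒜 ℳ hAB hm hli), ?_⟩
  convert! h.hasExpansion_hilb_top_of_smul_top_le (dualGrading 𝒜 ℳ) hs0 hs hG
    (smul_mem_span_range_dualFamily hli hsm)
    (hasExpansion_hilb_span_of_linearIndependent 𝒜 (dualGrading 𝒜 ℳ) hAB hf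
      (linearIndependent_dualFamily hli hsm hs0)) using 1
  rw [h.leadCoeff_smul_top_span_dualFamily ℳ hs0 hs hm hli hsm, Finset.sum_sub_distrib,
    Finset.sum_const, Finset.card_univ, nsmul_eq_mul]
  ring

end DualExpansion

section RankAndDegree

variable {k R M : Type*} [Field k] [CommRing R] [IsDomain R] [IsIntegrallyClosed R]
  [IsNoetherianRing R] [Algebra k R] [AddCommGroup M] [Module k M] [Module R M]
  [IsScalarTower k R M] [Module.Finite R M] [Module.IsTorsionFree R M]
  (𝒜 : ℝ → Submodule k R) [GradedAlgebra 𝒜]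
  (ℳ : ℝ → Submodule k M) [DirectSum.Decomposition ℳ] [SetLike.GradedSMul 𝒜 ℳ]

lemma finrank_dual_eq_and_exists_hasExpansion [DirectSum.Decomposition (dualGrading 𝒜 ℳ)]
    [∀ x, FiniteDimensional k (gradedLE 𝒜 x)] [∀ x, FiniteDimensional k (gradedLE ℳ x)]
    [∀ x, FiniteDimensional k (gradedLE (dualGrading 𝒜 ℳ) x)] {d : ℕ}
    (h : HasPrimeExpansions 𝒜 d) {A B : ℝ}
    (hAB : HasExpansion (d + 1) (hilb 𝒜 (⊤ : Ideal R)) A B) :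
    Module.finrank R (Module.Dual R M) = Module.finrank R M ∧
      ∃ α β, HasExpansion (d + 1) (hilb ℳ (⊤ : Submodule R M)) α β ∧
        HasExpansion (d + 1) (hilb (dualGrading 𝒜 ℳ) (⊤ : Submodule R (Module.Dual R M))) α
          (2 * Module.finrank R M * B - β) := by
  have : IsNoetherian R (Module.Dual R M) := isNoetherian_linearMap R R M
  obtain ⟨S, e, he, hli, htors⟩ := exists_homogeneous_linearIndependent (R := R) ℳ
  obtain ⟨δ, s, hs, hs0, hsN⟩ := exists_homogeneous_smul_mem ℳ 𝒜
    (isHomogeneous_span 𝒜 ℳ fun g hg => ⟨e g, he g hg⟩) htors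
  have hsm : ∀ x, s • x ∈ Submodule.span R (Set.range ((↑) : S → M)) := by
    rwa [show Set.range ((↑) : S → M) = S from Subtype.range_coe]
  have hrank := finrank_eq_card_of_smul_mem_span hli hs0 hsm
  refine ⟨?_, ?_⟩
  · rw [hrank, finrank_eq_card_of_smul_mem_span (linearIndependent_dualFamily hli hsm hs0) hs0
      (smul_mem_span_range_dualFamily hli hsm)]
  · rw [hrank]
    exact h.exists_hasExpansion_dual ℳ hs0 hs (fun i : S => he i i.2) hli hsm hAB

end RankAndDegree

end

theorem mainTheorem7_general {k R M : Type*} [Field k]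
    [CommRing R] [IsDomain R] [IsIntegrallyClosed R] [Algebra k R] [IsNoetherianRing R]
    (𝒜 : ℝ → Submodule k R) [GradedAlgebra 𝒜]
    (hneg : ∀ t < 0, 𝒜 t = ⊥)
    (hzero : ∀ r ∈ 𝒜 0, ∃ c : k, algebraMap k R c = r)
    (n : ℕ) (hn : ringKrullDim R = n) (hn1 : 1 ≤ n)
    [AddCommGroup M] [Module k M] [Module R M] [IsScalarTower k R M]
    [Module.Finite R M] [Module.IsTorsionFree R M]
    (ℳ : ℝ → Submodule k M) [DirectSum.Decomposition ℳ] [SetLike.GradedSMul 𝒜 ℳ] :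
    (HasRRCoeffs n 𝒜 ∧ HasRRCoeffs n ℳ ∧ HasRRCoeffs n (dualGrading 𝒜 ℳ)) ∧
      gradedDegree n 𝒜 (dualGrading 𝒜 ℳ) = -gradedDegree n 𝒜 ℳ := by
  classical
  obtain ⟨d, rfl⟩ := Nat.exists_eq_add_of_le' hn1
  have : IsNoetherian R (Module.Dual R M) := isNoetherian_linearMap R R M
  let _ : DirectSum.Decomposition (dualGrading 𝒜 ℳ) :=
    (dualGrading_isInternal 𝒜 ℳ).chooseDecomposition
  have hRfin := finiteDimensional_gradedLE_self 𝒜 hneg hzero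
  have hMfin := finiteDimensional_gradedLE 𝒜 ℳ
  have hDfin := finiteDimensional_gradedLE 𝒜 (dualGrading 𝒜 ℳ)
  obtain ⟨A, B, hAB⟩ := expandable_hilb_top 𝒜 hneg hzero hn
  obtain ⟨hrank, α, β, hM, hD⟩ := finrank_dual_eq_and_exists_hasExpansion 𝒜 ℳ
    (hasPrimeExpansions 𝒜 hneg hzero hn) hAB
  rw [hilb_top] at hAB hM hD
  have hR' := IsRRCoeffs.of_hasExpansion hn1 hRfin hAB
  have hM' := IsRRCoeffs.of_hasExpansion hn1 hMfin hM
  have hD' := IsRRCoeffs.of_hasExpansion hn1 hDfin hD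
  refine ⟨⟨⟨_, _, hR'⟩, ⟨_, _, hM'⟩, ⟨_, _, hD'⟩⟩, ?_⟩
  rw [gradedDegree, gradedDegree, hR'.subCoeff_eq hn1, hM'.subCoeff_eq hn1, hD'.subCoeff_eq hn1,
    hrank]
  ring

theorem mainTheorem7 {k R M : Type*} [Field k] [IsAlgClosed k]
    [CommRing R] [IsDomain R] [IsIntegrallyClosed R] [Algebra k R] [Algebra.FiniteType k R]
    (𝒜 : ℝ → Submodule k R) [GradedAlgebra 𝒜]
    (hneg : ∀ t < 0, 𝒜 t = ⊥)
    (hzero : ∀ r ∈ 𝒜 0, ∃ c : k, algebraMap k R c = r)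
    (n : ℕ) (hn : ringKrullDim R = n) (hn1 : 1 ≤ n)
    [AddCommGroup M] [Module k M] [Module R M] [IsScalarTower k R M]
    [Module.Finite R M] [Module.IsTorsionFree R M]
    (ℳ : ℝ → Submodule k M) [DirectSum.Decomposition ℳ] [SetLike.GradedSMul 𝒜 ℳ] :
    (HasRRCoeffs n 𝒜 ∧ HasRRCoeffs n ℳ ∧ HasRRCoeffs n (dualGrading 𝒜 ℳ)) ∧
      gradedDegree n 𝒜 (dualGrading 𝒜 ℳ) = -gradedDegree n 𝒜 ℳ := by
  have : IsNoetherianRing R := Algebra.FiniteType.isNoetherianRing k R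
  exact mainTheorem7_general 𝒜 hneg hzero n hn hn1 ℳ
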